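/- Let $W=\{W(x,t)\}_{(x,t)\in\mathbb R^2}$ be a real, zero mean, stationary Gaussian field with almost surely continuously differentiable sample paths, and assume that the Gaussian vector $(W,W_x,W_t)(0,0)$ is nondegenerate. Let $f$ be its joint normal density. Let $v\in\mathbb R$ be the velocity of a ship, let $Z(t)=W(vt,t)$ be the sea surface encountered by the ship, and define the distribution function of the slope at overtaking wave centers as the Palm distribution $$F^{\mathrm{enc}}_{W_x}(w)=\frac{\mathbb E\big[\#\{t\in[0,1]:\,Z(t)=0,\ Z_t(t)>0,\ W_x(vt,t)<0,\ W_x(vt,t)\le w\}\big]}{\mathbb E\big[\#\{t\in[0,1]:\,Z(t)=0,\ Z_t(t)>0,\ W_x(vt,t)<0\}\big]},\qquad w\in\mathbb R .$$ Let $V=-W_t(0,0)/W_x(0,0)$ be the local wave velocity at $(x,t)=(0,0)$, and write $y^+=\max(y,0)$, $y^-=\max(-y,0)$. For a function $g$, the expression $\mathbb E[g(W_x(0,0),W_t(0,0))\mid W(0,0)=0]\,f_{W(0,0)}(0)$ denotes the integral $\iint g(a,b)\,f(0,a,b)\,da\,db$ (and $(V-v)^+W_x(0,0)^-$ is read as $0$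 where $W_x(0,0)=0$). Then the denominator of $F^{\mathrm{enc}}_{W_x}$ is positive and finite and, for every $w\in\mathbb R$, $$F^{\mathrm{enc}}_{W_x}(w)=\frac{\mathbb E\big[(V-v)^+\,W_x(0,0)^-\,\mathbf 1_{\{W_x(0,0)\le w\}}\mid W(0,0)=0\big]\,f_{W(0,0)}(0)}{\mathbb E\big[(V-v)^+\,W_x(0,0)^-\mid W(0,0)=0\big]\,f_{W(0,0)}(0)},$$ where the denominator on the right-hand side is positive. -/

import Mathlib

open MeasureTheory ProbabilityTheory Set
open scoped ENNReal

namespace GaussianSea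

noncomputable section

variable {Ω : Type*} [MeasurableSpace Ω]

/-- Strict stationarity of a random field on the plane of points `(x, t)`: all finite-dimensional
distributions are invariant under translations. -/
def IsStationary (W : ℝ × ℝ → Ω → ℝ) (P : Measure Ω) : Prop :=
  ∀ (h : ℝ × ℝ) (n : ℕ) (p : Fin n → ℝ × ℝ),
    IdentDistrib (fun ω i => W (p i + h) ω) (fun ω i => W (p i) ω) P P

/-- A zero mean, stationary Gaussian field `W (x, t)` whose sample paths are almost surely
continuously differentiable functions of `(x, t)`. -/
structure IsGaussianSea (W : ℝ × ℝ → Ω → ℝ) (P : Measure Ω) : Prop where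
  gaussian : IsGaussianProcess W P
  mean_zero : ∀ p, ∫ ω, W p ω ∂P = 0
  stationary : IsStationary W P
  contDiff : ∀ᵐ ω ∂P, ContDiff ℝ 1 (fun p : ℝ × ℝ => W p ω)

/-- The partial derivative `W_x (x, t)` in space (the slope). -/
def Wx (W : ℝ × ℝ → Ω → ℝ) (x t : ℝ) (ω : Ω) : ℝ := deriv (fun y => W (y, t) ω) x

/-- The partial derivative `W_t (x, t)` in time. -/
def Wt (W : ℝ × ℝ → Ω → ℝ) (x t : ℝ) (ω : Ω) : ℝ := deriv (fun s => W (x, s) ω) t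

/-- The encountered sea `Z (t) = W (v t, t)`. -/
def encSea (W : ℝ × ℝ → Ω → ℝ) (v : ℝ) (t : ℝ) (ω : Ω) : ℝ := W (v * t, t) ω

/-- The times `t ∈ [0, 1]` at which a wave center overtakes the ship, that is `Z (t) = 0`,
`Z_t (t) > 0` and `W_x (v t, t) < 0`. -/
def overtakingTimes (W : ℝ × ℝ → Ω → ℝ) (v : ℝ) (ω : Ω) : Set ℝ :=
  {t | t ∈ Icc (0 : ℝ) 1 ∧ encSea W v t ω = 0 ∧ 0 < deriv (fun s => encSea W v s ω) t ∧
    Wx W (v * t) t ω < 0}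

/-- The expected number of overtaking times in `[0, 1]`. -/
def encIntensity (W : ℝ × ℝ → Ω → ℝ) (P : Measure Ω) (v : ℝ) : ℝ≥0∞ :=
  ∫⁻ ω, ((overtakingTimes W v ω).encard : ℝ≥0∞) ∂P

/-- The expected number of overtaking times in `[0, 1]` at which the slope is at most `w`. -/
def encIntensityLe (W : ℝ × ℝ → Ω → ℝ) (P : Measure Ω) (v w : ℝ) : ℝ≥0∞ :=
  ∫⁻ ω, ((overtakingTimes W v ω ∩ {t | Wx W (v * t) t ω ≤ w}).encard : ℝ≥0∞) ∂P

/-- The Palm distribution function of the slope at encountered overtaking wave centers. -/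
def encSlopeCDF (W : ℝ × ℝ → Ω → ℝ) (P : Measure Ω) (v w : ℝ) : ℝ :=
  (encIntensityLe W P v w / encIntensity W P v).toReal

/-- The density of the (nondegenerate) normal distribution with mean `m` and covariance
matrix `S`. -/
def normalDensity {n : ℕ} (m : Fin n → ℝ) (S : Matrix (Fin n) (Fin n) ℝ) (x : Fin n → ℝ) : ℝ :=
  Real.exp (-((x - m) ⬝ᵥ (S⁻¹.mulVec (x - m))) / 2) / Real.sqrt ((2 * Real.pi) ^ n * S.det)

/-- The vector of means of a finite family of random variables. -/
def meanVec {n : ℕ} (X : Fin n → Ω → ℝ) (P : Measure Ω) : Fin n → ℝ :=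
  fun i => ∫ ω, X i ω ∂P

/-- The covariance matrix of a finite family of random variables. -/
def covMatrix {n : ℕ} (X : Fin n → Ω → ℝ) (P : Measure Ω) : Matrix (Fin n) (Fin n) ℝ :=
  Matrix.of fun i j => cov[X i, X j; P]

/-- The random vector `(W, W_x, W_t)` at `(x, t) = (0, 0)`. -/
def jet (W : ℝ × ℝ → Ω → ℝ) : Fin 3 → Ω → ℝ :=
  ![W (0, 0), Wx W 0 0, Wt W 0 0]

/-- `E[g (W_x (0,0), W_t (0,0)) | W (0,0) = u] * f_{W (0,0)} (u)`, read as the integral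
`∫∫ g (a, b) f (u, a, b) da db`, where `f` is the joint (normal) density of
`(W, W_x, W_t)` at `(0, 0)`. -/
def condExpMulDensity (W : ℝ × ℝ → Ω → ℝ) (P : Measure Ω) (g : ℝ → ℝ → ℝ) (u : ℝ) : ℝ :=
  ∫ y : ℝ × ℝ, g y.1 y.2 *
    normalDensity (meanVec (jet W) P) (covMatrix (jet W) P) ![u, y.1, y.2]

/-- The local velocity `V = - W_t / W_x` as a function of the values `a = W_x` and `b = W_t`.
It is only used with the weight `a⁻`, which vanishes at `a = 0`. -/
def velocity (a b : ℝ) : ℝ := -b / a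

end

end GaussianSea

namespace GaussianSea

open Filter Topology

/-! Everything reduces to a Rice formula for marked crossings: the expected number of t in [0, 1]
with Z = 0, Z_t > 0, W_x < 0 and W_x ≤ w is the integral of (v a + b)⁺ f(0, a, b) over a < 0, a ≤ w
(`IsGaussianSea.encIntensityLe_eq`). For a < 0 this weight is (V - v)⁺ a⁻, because -a (-b/a - v) = v
a + b, so the claimed quotient is a ratio of two such intensities.

The intensity is found by counting on dyadic grids. A cell counts if Z passes from ≤ 0 to > 0 across
it and a mark built from difference quotients, approximating (W_x, W_t), lies in A. By stationarity
the mean count is 2ⁿ times the probability for one cell at the origin. There regression splits the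
mark as R + Z c with R independent of Z. Rescaling the value of Z by the mesh, the probability per
mesh length tends to f_Z(0) E[ℓ(R₀)⁺; R₀ ∈ A] with ℓ(a, b) = v a + b (`tendsto_measure_upcrossing`),
and f_Z(0) times the law of R₀ has density f(0, a, b) (`lintegral_residual`). Convexity of A makes
the frontiers that matter null.

The passage from grids to zeros is pathwise and one-sided. The grid eventually sees any finite set
of zeros with positive derivative and marks in an open set, so Fatou gives an upper bound
(`IsGaussianSea.lintegral_encard_le`). For a closed set of marks that forces a positive derivative,
grid steps are eventually matched injectively with zeros, and reverse Fatou gives a lower bound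
(`IsGaussianSea.le_lintegral_encard`); its majorant is the supremum of the unmarked counts, which
increase under refinement. Approximating the set of marks by open convex sets from outside and
closed convex sets from inside closes the gap. Tangential zeros never have to be excluded, and the
number of zeros need not be measurable, since `∫⁻` is monotone without measurability. -/

/-- The function `Z` crosses zero upwards between `s` and `s + h`, with a mark in `A`. -/
def UpStep (Z : ℝ → ℝ) (m : ℝ → ℝ → ℝ × ℝ) (A : Set (ℝ × ℝ)) (h s : ℝ) : Prop :=
  Z s ≤ 0 ∧ 0 < Z (s + h) ∧ m h s ∈ A

open Classical in
/-- The number of cells of the dyadic grid of mesh `2⁻ⁿ` in `[0, 1]` over which `Z` crosses zero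
upwards with a mark in `A`. -/
noncomputable def gridCount (Z : ℝ → ℝ) (m : ℝ → ℝ → ℝ × ℝ) (A : Set (ℝ × ℝ)) (n : ℕ) : ℕ :=
  ((Finset.range (2 ^ n)).filter fun k : ℕ => UpStep Z m A ((1 / 2) ^ n) (k * (1 / 2) ^ n)).card

/-! ### Pathwise comparison of zeros with dyadic grid counts -/

/-- Strict differentiability compares two free points near t with relative error d/2; an ordinary
derivative would only compare each of them with t itself. -/
theorem eventually_lt_of_hasStrictDerivAt {Z : ℝ → ℝ} {d t : ℝ} (hZ : HasStrictDerivAt Z d t)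
    (hd : 0 < d) : ∀ᶠ p : ℝ × ℝ in 𝓝 (t, t), p.1 < p.2 → Z p.1 < Z p.2 := by
  have h := hZ.isLittleO.def (half_pos hd)
  filter_upwards [h] with p hp hlt
  have h1 : ‖p.1 - p.2‖ = p.2 - p.1 := by
    rw [Real.norm_eq_abs, abs_of_neg (by linarith)]; ring
  rw [h1, Real.norm_eq_abs] at hp
  have h2 := (abs_le.1 hp).2
  simp only [ContinuousLinearMap.toSpanSingleton_apply, smul_eq_mul] at h2
  nlinarith [mul_pos hd (sub_pos.2 hlt)]

theorem exists_mem_nhds_strictMonoOn {Z : ℝ → ℝ} {d t : ℝ} (hZ : HasStrictDerivAt Z d t)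
    (hd : 0 < d) : ∃ J ∈ 𝓝 t, J.OrdConnected ∧ StrictMonoOn Z J := by
  have h := eventually_lt_of_hasStrictDerivAt hZ hd
  obtain ⟨ε, hε, hball⟩ := Metric.eventually_nhds_iff_ball.1 h
  refine ⟨Metric.ball t ε, Metric.ball_mem_nhds t hε, ?_, fun x hx y hy hxy => ?_⟩
  · rw [Real.ball_eq_Ioo]; exact ordConnected_Ioo
  · exact hball (x, y) (by rw [← ball_prod_same]; exact ⟨hx, hy⟩) hxy

/-- When a crossed cell is halved, the sign at the midpoint decides which half inherits the
crossing. The argument is for unmarked steps, since marks change with the mesh; these counts supply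
the increasing majorant for reverse Fatou. -/
theorem gridCount_mono {Z : ℝ → ℝ} {m : ℝ → ℝ → ℝ × ℝ} :
    Monotone (gridCount Z m univ) := by
  classical
  refine monotone_nat_of_le_succ fun n => ?_
  set h : ℝ := (1 / 2) ^ (n + 1) with hh
  have hn : ((1 : ℝ) / 2) ^ n = 2 * h := by rw [hh, pow_succ]; ring
  have key : ∀ k : ℕ, UpStep Z m univ (2 * h) (k * (2 * h)) →
      UpStep Z m univ h ((2 * k : ℕ) * h) ∨ UpStep Z m univ h ((2 * k + 1 : ℕ) * h) := by
    rintro k ⟨h1, h2, -⟩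
    have e1 : ((2 * k : ℕ) : ℝ) * h = k * (2 * h) := by push_cast; ring
    have e2 : ((2 * k : ℕ) : ℝ) * h + h = ((2 * k + 1 : ℕ) : ℝ) * h := by push_cast; ring
    have e3 : ((2 * k + 1 : ℕ) : ℝ) * h + h = k * (2 * h) + 2 * h := by push_cast; ring
    by_cases hc : Z (((2 * k + 1 : ℕ) : ℝ) * h) ≤ 0
    · exact Or.inr ⟨hc, by rwa [e3], mem_univ _⟩
    · exact Or.inl ⟨by rwa [e1], by rw [e2]; exact not_le.1 hc, mem_univ _⟩
  let φ : ℕ → ℕ := fun k => if UpStep Z m univ h ((2 * k : ℕ) * h) then 2 * k else 2 * k + 1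
  have hφ : ∀ k, φ k / 2 = k := by
    intro k; simp only [φ]; split_ifs <;> omega
  unfold gridCount
  rw [← hh, hn]
  refine Finset.card_le_card_of_injOn φ ?_ ?_
  · intro k hk
    simp only [Finset.coe_filter, Finset.mem_range, mem_ofPred_eq] at hk ⊢
    refine ⟨?_, ?_⟩
    · have := hφ k
      rw [pow_succ]
      omega
    · rcases key k hk.2 with h1 | h1
      · simp only [φ, if_pos h1]; exact h1
      · by_cases h0 : UpStep Z m univ h ((2 * k : ℕ) * h)
        · simp only [φ, if_pos h0]; exact h0
        · simp only [φ, if_neg h0]; exact h1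
  · intro a _ b _ hab
    rw [← hφ a, ← hφ b, hab]

theorem tendsto_half_pow : Tendsto (fun n : ℕ => ((1 : ℝ) / 2) ^ n) atTop (𝓝[>] 0) :=
  tendsto_nhdsWithin_iff.2 ⟨tendsto_pow_atTop_nhds_zero_of_lt_one (by norm_num) (by norm_num),
    Eventually.of_forall fun n => by simp⟩

/-- For a closed set of marks which forces a positive derivative, the grid counts are eventually
bounded by the number of marked zeros. -/
theorem eventually_gridCount_le_encard {Z Z' : ℝ → ℝ} {m : ℝ → ℝ → ℝ × ℝ} {m₀ : ℝ → ℝ × ℝ}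
    {K : Set (ℝ × ℝ)} (hK : IsClosed K) (hZ : ∀ s, HasStrictDerivAt Z (Z' s) s)
    (hm : ∀ s, Tendsto (fun p : ℝ × ℝ => m p.1 p.2) (𝓝[>] 0 ×ˢ 𝓝 s) (𝓝 (m₀ s)))
    (hpos : ∀ s, m₀ s ∈ K → 0 < Z' s) :
    ∀ᶠ n in atTop, (gridCount Z m K n : ℕ∞) ≤
      {t | t ∈ Icc (0 : ℝ) 1 ∧ Z t = 0 ∧ m₀ t ∈ K}.encard := by
  classical
  have hJ : ∀ t, ∃ J ∈ 𝓝 t, m₀ t ∈ K → J.OrdConnected ∧ StrictMonoOn Z J := by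
    intro t
    by_cases ht : m₀ t ∈ K
    · obtain ⟨J, h1, h2⟩ := exists_mem_nhds_strictMonoOn (hZ t) (hpos t ht)
      exact ⟨J, h1, fun _ => h2⟩
    · exact ⟨univ, univ_mem, fun h => absurd h ht⟩
  choose J hJn hJm using hJ
  set T := {t | t ∈ Icc (0 : ℝ) 1 ∧ Z t = 0 ∧ m₀ t ∈ K} with hT
  have hcont : Continuous Z := continuous_iff_continuousAt.2 fun s => (hZ s).hasDerivAt.continuousAt
  -- Compactness of [0, 1] makes a local alternative uniform: near a marked zero y the neighbourhood
  -- `J y` serves; near any other zero the mark stays in the open complement of K; near a nonzero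
  -- value Z has constant sign, so there is no step.
  have hloc : ∀ᶠ h in 𝓝 (0 : ℝ), ∀ s ∈ Icc (0 : ℝ) 1,
      0 < h → UpStep Z m K h s → ∃ t ∈ T, s ∈ J t := by
    refine isCompact_Icc.eventually_forall_of_forall_eventually fun y hy => ?_
    have hsnd : Tendsto (fun p : ℝ × ℝ => p.2) (𝓝 ((0 : ℝ), y)) (𝓝 y) := continuous_snd.tendsto _
    by_cases hyT : y ∈ T
    · filter_upwards [hsnd (hJn y)] with p hp _ _
      exact ⟨y, hyT, hp⟩
    · by_cases hZy : Z y = 0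
      · have hmy : m₀ y ∈ Kᶜ := fun h => hyT ⟨hy, hZy, h⟩
        have h1 := (hm y) (hK.isOpen_compl.mem_nhds hmy)
        have h2 : ∀ᶠ p : ℝ × ℝ in 𝓝 ((0 : ℝ), y), 0 < p.1 → m p.1 p.2 ∈ Kᶜ := by
          have h3 : ∀ᶠ p : ℝ × ℝ in 𝓝[>] 0 ×ˢ 𝓝 y, m p.1 p.2 ∈ Kᶜ := h1
          rw [← nhdsWithin_univ y, ← nhdsWithin_prod_eq, eventually_nhdsWithin_iff] at h3
          filter_upwards [h3] with p hp hp0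
          exact hp ⟨hp0, mem_univ _⟩
        filter_upwards [h2] with p hp hp0 hU
        exact absurd hU.2.2 (hp hp0)
      · have hsum : Tendsto (fun p : ℝ × ℝ => Z (p.2 + p.1)) (𝓝 ((0 : ℝ), y)) (𝓝 (Z y)) := by
          have : Continuous fun p : ℝ × ℝ => Z (p.2 + p.1) := by fun_prop
          simpa using this.tendsto ((0 : ℝ), y)
        have hsnd' : Tendsto (fun p : ℝ × ℝ => Z p.2) (𝓝 ((0 : ℝ), y)) (𝓝 (Z y)) :=
          (hcont.tendsto y).comp hsnd
        rcases lt_or_gt_of_ne hZy with hneg | hpos'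
        · filter_upwards [hsum (Iio_mem_nhds hneg)] with p hp _ hU
          exact absurd hU.2.1 (not_lt.2 (le_of_lt hp))
        · filter_upwards [hsnd' (Ioi_mem_nhds hpos')] with p hp _ hU
          exact absurd hU.1 (not_le.2 hp)
  have hpow : Tendsto (fun n : ℕ => ((1 : ℝ) / 2) ^ n) atTop (𝓝 0) :=
    tendsto_half_pow.mono_right nhdsWithin_le_nhds
  filter_upwards [hpow hloc] with n hn
  set h : ℝ := (1 / 2) ^ n with hh
  have hh0 : 0 < h := by positivity
  have hh1 : h * 2 ^ n = 1 := by rw [hh, ← mul_pow]; norm_num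
  set S := (Finset.range (2 ^ n)).filter fun k : ℕ => UpStep Z m K h (k * h) with hS
  have hex : ∀ k ∈ S, ∃ t ∈ T, (k : ℝ) * h ∈ J t := by
    intro k hk
    rw [hS, Finset.mem_filter, Finset.mem_range] at hk
    refine hn _ ⟨by positivity, ?_⟩ hh0 hk.2
    have : (k : ℝ) ≤ 2 ^ n := by exact_mod_cast hk.1.le
    nlinarith
  choose! τ hτT hτJ using hex
  -- Two cells assigned to the same zero would lie in an interval where Z increases strictly,
  -- although Z is positive at the end of the first and nonpositive at the start of the second.
  have hinj : InjOn τ S := by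
    have aux : ∀ a ∈ S, ∀ b ∈ S, τ a = τ b → ¬ a < b := by
      intro a ha b hb hab hlt
      have ha' := (Finset.mem_filter.1 ha).2
      have hb' := (Finset.mem_filter.1 hb).2
      obtain ⟨hord, hmono⟩ := hJm _ (hτT a ha).2.2
      have hbJ : (b : ℝ) * h ∈ J (τ a) := hab ▸ hτJ b hb
      have hle : (a : ℝ) * h + h ≤ b * h := by
        have : (a : ℝ) + 1 ≤ b := by exact_mod_cast hlt
        nlinarith
      have hmid := hord.out (hτJ a ha) hbJ ⟨by linarith, hle⟩
      have := hmono.monotoneOn hmid hbJ hle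
      linarith [ha'.2.1, hb'.1]
    intro a ha b hb hab
    rcases lt_trichotomy a b with h1 | h1 | h1
    · exact absurd h1 (aux a ha b hb hab)
    · exact h1
    · exact absurd h1 (aux b hb a ha hab.symm)
  calc ((S.card : ℕ) : ℕ∞) = (S : Set ℕ).encard := (encard_coe_eq_coe_finsetCard S).symm
    _ = (τ '' S).encard := hinj.encard_image.symm
    _ ≤ T.encard := encard_le_encard (by rintro _ ⟨k, hk, rfl⟩; exact hτT k hk)

theorem floor_grid_spec {t : ℝ} (ht : 0 ≤ t) (n : ℕ) :
    (⌊t * 2 ^ n⌋₊ : ℝ) * (1 / 2) ^ n ≤ t ∧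
      t < (⌊t * 2 ^ n⌋₊ : ℝ) * (1 / 2) ^ n + (1 / 2) ^ n := by
  have hh0 : (0 : ℝ) < (1 / 2) ^ n := by positivity
  have hh1 : (2 : ℝ) ^ n * (1 / 2) ^ n = 1 := by rw [← mul_pow]; norm_num
  have h1 := Nat.floor_le (show 0 ≤ t * 2 ^ n by positivity)
  have h2 := Nat.lt_floor_add_one (t * 2 ^ n)
  constructor
  · calc _ ≤ (t * 2 ^ n) * (1 / 2) ^ n := by gcongr
      _ = t := by rw [mul_assoc, hh1, mul_one]
  · calc t = (t * 2 ^ n) * (1 / 2) ^ n := by rw [mul_assoc, hh1, mul_one]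
      _ < (⌊t * 2 ^ n⌋₊ + 1) * (1 / 2) ^ n := by gcongr
      _ = _ := by ring

theorem tendsto_floor_grid {t : ℝ} (ht : 0 ≤ t) :
    Tendsto (fun n : ℕ => (⌊t * 2 ^ n⌋₊ : ℝ) * (1 / 2) ^ n) atTop (𝓝 t) := by
  have hpow : Tendsto (fun n : ℕ => ((1 : ℝ) / 2) ^ n) atTop (𝓝 0) :=
    tendsto_half_pow.mono_right nhdsWithin_le_nhds
  refine tendsto_of_tendsto_of_tendsto_of_le_of_le (by simpa only [sub_zero] using hpow.const_sub t)
    tendsto_const_nhds (fun n => ?_) (fun n => (floor_grid_spec ht n).1)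
  have := (floor_grid_spec ht n).2
  simp only
  linarith

/-- The number of zeros with positive derivative and marks in an open set is at most the lower
limit of the grid counts. -/
theorem encard_le_liminf_gridCount {Z Z' : ℝ → ℝ} {m : ℝ → ℝ → ℝ × ℝ} {m₀ : ℝ → ℝ × ℝ}
    {U : Set (ℝ × ℝ)} (hU : IsOpen U) (hZ : ∀ s, HasStrictDerivAt Z (Z' s) s)
    (hm : ∀ s, Tendsto (fun p : ℝ × ℝ => m p.1 p.2) (𝓝[>] 0 ×ˢ 𝓝 s) (𝓝 (m₀ s)))
    (h1 : Z 1 ≠ 0) :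
    (({t | t ∈ Icc (0 : ℝ) 1 ∧ Z t = 0 ∧ 0 < Z' t ∧ m₀ t ∈ U}.encard : ℕ∞) : ℝ≥0∞) ≤
      liminf (fun n => (gridCount Z m U n : ℝ≥0∞)) atTop := by
  classical
  set T := {t | t ∈ Icc (0 : ℝ) 1 ∧ Z t = 0 ∧ 0 < Z' t ∧ m₀ t ∈ U} with hT
  have hstep : ∀ t ∈ T, ∀ᶠ n : ℕ in atTop,
      UpStep Z m U ((1 / 2) ^ n) ((⌊t * 2 ^ n⌋₊ : ℝ) * (1 / 2) ^ n) := by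
    intro t ht
    have hs := tendsto_floor_grid ht.1.1
    have hpow : Tendsto (fun n : ℕ => ((1 : ℝ) / 2) ^ n) atTop (𝓝 0) :=
      tendsto_half_pow.mono_right nhdsWithin_le_nhds
    have hs' := hs.add hpow
    rw [add_zero] at hs'
    have hc : Tendsto (fun _ : ℕ => t) atTop (𝓝 t) := tendsto_const_nhds
    have hlt := eventually_lt_of_hasStrictDerivAt (hZ t) ht.2.2.1
    have e1 := (hs.prodMk_nhds hc).eventually hlt
    have e2 := (hc.prodMk_nhds hs').eventually hlt
    have e3 := ((hm t).comp (tendsto_half_pow.prodMk hs)).eventually (hU.mem_nhds ht.2.2.2)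
    filter_upwards [e1, e2, e3] with n h1 h2 h3
    obtain ⟨f1, f2⟩ := floor_grid_spec ht.1.1 n
    refine ⟨?_, ?_, h3⟩
    · rcases f1.lt_or_eq with f | f
      · exact (ht.2.1 ▸ h1 f).le
      · rw [f, ht.2.1]
    · have := h2 f2
      rwa [ht.2.1] at this
  have hfin : ∀ F : Finset ℝ, (F : Set ℝ) ⊆ T →
      (F.card : ℝ≥0∞) ≤ liminf (fun n => (gridCount Z m U n : ℝ≥0∞)) atTop := by
    intro F hF
    refine le_liminf_of_le (by isBoundedDefault) ?_
    have e1 : ∀ᶠ n : ℕ in atTop, ∀ t ∈ F,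
        UpStep Z m U ((1 / 2) ^ n) ((⌊t * 2 ^ n⌋₊ : ℝ) * (1 / 2) ^ n) :=
      (Finset.eventually_all F).2 fun t ht => hstep t (hF ht)
    -- Once the mesh is below the smallest gap in F, distinct zeros occupy distinct cells.
    have e2 : ∀ᶠ n : ℕ in atTop, ∀ t ∈ F, ∀ t' ∈ F, t ≠ t' → ((1 : ℝ) / 2) ^ n < |t - t'| := by
      refine (Finset.eventually_all F).2 fun t _ => (Finset.eventually_all F).2 fun t' _ => ?_
      by_cases htt : t = t'
      · exact Eventually.of_forall fun n h => absurd htt h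
      · have hpow : Tendsto (fun n : ℕ => ((1 : ℝ) / 2) ^ n) atTop (𝓝 0) :=
          tendsto_half_pow.mono_right nhdsWithin_le_nhds
        filter_upwards [hpow (Iio_mem_nhds (abs_pos.2 (sub_ne_zero.2 htt)))] with n hn _
        exact hn
    filter_upwards [e1, e2] with n hn1 hn2
    have : F.card ≤ gridCount Z m U n := by
      refine Finset.card_le_card_of_injOn (fun t => ⌊t * 2 ^ n⌋₊) ?_ ?_
      · intro t ht
        have htT := hF ht
        simp only [Finset.coe_filter, Finset.mem_range, mem_ofPred_eq]
        refine ⟨?_, hn1 t ht⟩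
        -- A zero at t = 1 would have cell index 2ⁿ, just outside the range that is counted.
        have ht1 : t < 1 := lt_of_le_of_ne htT.1.2 fun h => h1 (h ▸ htT.2.1)
        rw [Nat.floor_lt (by have := htT.1.1; positivity)]
        push_cast
        have : (0 : ℝ) < 2 ^ n := by positivity
        nlinarith
      · intro t ht t' ht' hEq
        by_contra hne
        have hd := hn2 t ht t' ht' hne
        obtain ⟨a1, a2⟩ := floor_grid_spec (hF ht).1.1 n
        obtain ⟨b1, b2⟩ := floor_grid_spec (hF ht').1.1 n
        simp only at hEq
        rw [hEq] at a1 a2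
        exact absurd hd (not_lt.2 (abs_le.2 ⟨by linarith, by linarith⟩))
    exact_mod_cast this
  by_cases hTf : T.Finite
  · have h := hfin hTf.toFinset (by simp)
    rwa [hTf.encard_eq_coe_toFinset_card]
  -- With infinitely many zeros, finite subsets of every size push the lower limit to infinity.
  · rw [Set.Infinite.encard_eq hTf, ENat.toENNReal_top]
    refine le_of_tendsto' ENNReal.tendsto_nat_nhds_top fun N => ?_
    obtain ⟨F, hF, hN⟩ := Set.Infinite.exists_subset_card_eq hTf N
    exact hN ▸ hfin F hF

/-! ### Difference quotients of a continuously differentiable field -/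

/-- The base point moves together with the step because grid points only approach the zero;
strictness of the derivative is what allows this joint limit. -/
theorem _root_.HasStrictDerivAt.tendsto_slope_prod {Z : ℝ → ℝ} {d s : ℝ}
    (hZ : HasStrictDerivAt Z d s) :
    Tendsto (fun p : ℝ × ℝ => (Z (p.2 + p.1) - Z p.2) / p.1) (𝓝[>] 0 ×ˢ 𝓝 s) (𝓝 d) := by
  have h1 : Tendsto (fun p : ℝ × ℝ => (p.2 + p.1, p.2)) (𝓝[>] 0 ×ˢ 𝓝 s) (𝓝 (s, s)) := by
    have h2 : Tendsto (fun p : ℝ × ℝ => (p.2 + p.1, p.2)) (𝓝 ((0 : ℝ), s)) (𝓝 (s, s)) := by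
      have : Continuous fun p : ℝ × ℝ => (p.2 + p.1, p.2) := by fun_prop
      simpa using this.tendsto ((0 : ℝ), s)
    rw [nhds_prod_eq] at h2
    exact h2.mono_left (prod_mono nhdsWithin_le_nhds le_rfl)
  have h3 := hZ.isLittleO.comp_tendsto h1
  have hpos : ∀ᶠ p : ℝ × ℝ in 𝓝[>] 0 ×ˢ 𝓝 s, p.1 ≠ 0 := by
    have : ∀ᶠ x : ℝ in 𝓝[>] 0, x ≠ 0 := by
      filter_upwards [self_mem_nhdsWithin] with x hx using ne_of_gt hx
    exact tendsto_fst.eventually this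
  have h4 : Tendsto (fun p : ℝ × ℝ => (Z (p.2 + p.1) - Z p.2) / p.1 - d)
      (𝓝[>] 0 ×ˢ 𝓝 s) (𝓝 0) := by
    refine (h3.tendsto_div_nhds_zero).congr' ?_
    filter_upwards [hpos] with p hp
    simp only [Function.comp_apply, ContinuousLinearMap.toSpanSingleton_apply, smul_eq_mul]
    rw [add_sub_cancel_left]
    field_simp
  simpa using h4.add_const d

/-- The mark read off from increments of the field: the difference quotient in space and
the difference quotient along the course of the ship, corrected to approximate the time
derivative. -/
noncomputable def diffMark (F : ℝ × ℝ → ℝ) (v h s : ℝ) : ℝ × ℝ :=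
  ((F (v * s + h, s) - F (v * s, s)) / h,
    (F (v * (s + h), s + h) - F (v * s, s)) / h - v * ((F (v * s + h, s) - F (v * s, s)) / h))

section PathDerivatives

variable {F : ℝ × ℝ → ℝ}

theorem hasStrictDerivAt_course (hF : ContDiff ℝ 1 F) (v t : ℝ) :
    HasStrictDerivAt (fun s => F (v * s, s))
      (v * deriv (fun y => F (y, t)) (v * t) + deriv (fun s => F (v * t, s)) t) t := by
  have hS := hF.contDiffAt.hasStrictFDerivAt (x := (v * t, t)) one_ne_zero
  have hx : deriv (fun y => F (y, t)) (v * t) = fderiv ℝ F (v * t, t) (1, 0) :=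
    (hS.hasFDerivAt.comp_hasDerivAt_of_eq (v * t)
      ((hasDerivAt_id (v * t)).prodMk (hasDerivAt_const (v * t) t)) rfl).deriv
  have ht : deriv (fun s => F (v * t, s)) t = fderiv ℝ F (v * t, t) (0, 1) :=
    (hS.hasFDerivAt.comp_hasDerivAt_of_eq t
      ((hasDerivAt_const t (v * t)).prodMk (hasDerivAt_id t)) rfl).deriv
  have hc : HasStrictDerivAt (fun s : ℝ => (v * s, s)) (v, 1) t := by
    have := ((hasStrictDerivAt_id t).const_mul v).prodMk (hasStrictDerivAt_id t)
    simpa using this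
  have := hS.comp_hasStrictDerivAt_of_eq t hc rfl
  rw [hx, ht, ← smul_eq_mul, ← map_smul, ← map_add,
    show v • ((1 : ℝ), (0 : ℝ)) + (0, 1) = (v, 1) by ext <;> simp]
  exact this

/-- The quotient along the course tends to v W_x + W_t, so subtracting v times the spatial quotient
leaves W_t. -/
theorem tendsto_diffMark (hF : ContDiff ℝ 1 F) (v t : ℝ) :
    Tendsto (fun p : ℝ × ℝ => diffMark F v p.1 p.2) (𝓝[>] 0 ×ˢ 𝓝 t)
      (𝓝 (deriv (fun y => F (y, t)) (v * t), deriv (fun s => F (v * t, s)) t)) := by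
  have hS := hF.contDiffAt.hasStrictFDerivAt (x := (v * t, t)) one_ne_zero
  have hx : deriv (fun y => F (y, t)) (v * t) = fderiv ℝ F (v * t, t) (1, 0) :=
    (hS.hasFDerivAt.comp_hasDerivAt_of_eq (v * t)
      ((hasDerivAt_id (v * t)).prodMk (hasDerivAt_const (v * t) t)) rfl).deriv
  have h1 : Tendsto (fun p : ℝ × ℝ => (F (v * p.2 + p.1, p.2) - F (v * p.2, p.2)) / p.1)
      (𝓝[>] 0 ×ˢ 𝓝 t) (𝓝 (deriv (fun y => F (y, t)) (v * t))) := by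
    have hlim : Tendsto (fun p : ℝ × ℝ => ((v * p.2 + p.1, p.2), (v * p.2, p.2)))
        (𝓝[>] 0 ×ˢ 𝓝 t) (𝓝 ((v * t, t), (v * t, t))) := by
      have h2 : Tendsto (fun p : ℝ × ℝ => ((v * p.2 + p.1, p.2), (v * p.2, p.2)))
          (𝓝 ((0 : ℝ), t)) (𝓝 ((v * t, t), (v * t, t))) := by
        have : Continuous fun p : ℝ × ℝ => ((v * p.2 + p.1, p.2), (v * p.2, p.2)) := by fun_prop
        simpa using this.tendsto ((0 : ℝ), t)
      rw [nhds_prod_eq] at h2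
      exact h2.mono_left (prod_mono nhdsWithin_le_nhds le_rfl)
    have h3 := hS.isLittleO.comp_tendsto hlim
    have hpos : ∀ᶠ p : ℝ × ℝ in 𝓝[>] 0 ×ˢ 𝓝 t, p.1 ≠ 0 := by
      have : ∀ᶠ x : ℝ in 𝓝[>] 0, x ≠ 0 := by
        filter_upwards [self_mem_nhdsWithin] with x hx using ne_of_gt hx
      exact tendsto_fst.eventually this
    have hdiff : ∀ p : ℝ × ℝ, ((v * p.2 + p.1, p.2) : ℝ × ℝ) - (v * p.2, p.2) = p.1 • (1, 0) := by
      intro p; ext <;> simp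
    have h3' : (fun p : ℝ × ℝ => F (v * p.2 + p.1, p.2) - F (v * p.2, p.2) -
        p.1 * deriv (fun y => F (y, t)) (v * t)) =o[𝓝[>] 0 ×ˢ 𝓝 t] fun p => p.1 := by
      refine (h3.congr_left fun p => ?_).trans_isBigO ?_
      · simp only [Function.comp_apply, hdiff, map_smul, hx, smul_eq_mul]
      · refine Asymptotics.IsBigO.of_bound 1 (Eventually.of_forall fun p => ?_)
        simp only [Function.comp_apply, hdiff, norm_smul, one_mul]
        simp [Prod.norm_def]
    have h4 : Tendsto (fun p : ℝ × ℝ => (F (v * p.2 + p.1, p.2) - F (v * p.2, p.2)) / p.1 -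
        deriv (fun y => F (y, t)) (v * t)) (𝓝[>] 0 ×ˢ 𝓝 t) (𝓝 0) := by
      refine (h3'.tendsto_div_nhds_zero).congr' ?_
      filter_upwards [hpos] with p hp
      field_simp
    simpa using h4.add_const (deriv (fun y => F (y, t)) (v * t))
  have h2 := (hasStrictDerivAt_course hF v t).tendsto_slope_prod
  have h3 := h1.prodMk_nhds (h2.sub (h1.const_mul v))
  rw [add_sub_cancel_left] at h3
  exact h3

end PathDerivatives

/-! ### Almost sure limits of Gaussian vectors -/

section AlmostSureLimits

variable {Ω : Type*} [MeasurableSpace Ω] {P : Measure Ω} [IsProbabilityMeasure P]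

theorem tendsto_charFun_map {X : ℕ → Ω → ℝ} {Y : Ω → ℝ} (hX : ∀ n, AEMeasurable (X n) P)
    (hY : AEMeasurable Y P) (hlim : ∀ᵐ ω ∂P, Tendsto (fun n => X n ω) atTop (𝓝 (Y ω))) (t : ℝ) :
    Tendsto (fun n => charFun (P.map (X n)) t) atTop (𝓝 (charFun (P.map Y) t)) := by
  have key : ∀ Z : Ω → ℝ, AEMeasurable Z P →
      charFun (P.map Z) t = ∫ ω, Complex.exp (t * Z ω * Complex.I) ∂P := by
    intro Z hZ
    rw [charFun_apply_real, integral_map hZ (by fun_prop)]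
  rw [key Y hY]
  simp_rw [key _ (hX _)]
  refine tendsto_integral_of_dominated_convergence (fun _ => 1) (fun n => ?_)
    (integrable_const 1) (fun n => ?_) ?_
  · exact (Continuous.measurable (by fun_prop : Continuous fun x : ℝ =>
      Complex.exp (t * x * Complex.I))).comp_aemeasurable (hX n) |>.aestronglyMeasurable
  · refine Eventually.of_forall fun ω => ?_
    rw [← Complex.ofReal_mul, Complex.norm_exp_ofReal_mul_I]
  · filter_upwards [hlim] with ω hω
    have : Continuous fun x : ℝ => Complex.exp (t * x * Complex.I) := by fun_prop
    exact (this.tendsto _).comp hω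

/-- An almost sure limit of centred Gaussian variables is centred Gaussian, and the variances
converge. -/
theorem hasGaussianLaw_of_tendsto_ae {X : ℕ → Ω → ℝ} {Y : Ω → ℝ}
    (hX : ∀ n, HasGaussianLaw (X n) P) (hX0 : ∀ n, ∫ ω, X n ω ∂P = 0)
    (hlim : ∀ᵐ ω ∂P, Tendsto (fun n => X n ω) atTop (𝓝 (Y ω))) :
    HasGaussianLaw Y P ∧ ∫ ω, Y ω ∂P = 0 ∧
      Tendsto (fun n => Var[X n; P]) atTop (𝓝 Var[Y; P]) := by
  have hY : AEMeasurable Y P := aemeasurable_of_tendsto_metrizable_ae atTop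
    (fun n => (hX n).aemeasurable) hlim
  have hc := tendsto_charFun_map (fun n => (hX n).aemeasurable) hY hlim
  have hcX : ∀ n t, charFun (P.map (X n)) t = Complex.exp (-(Var[X n; P] * t ^ 2 / 2 : ℝ)) := by
    intro n t
    rw [(hX n).map_eq_gaussianReal, hX0, charFun_gaussianReal,
      Real.coe_toNNReal _ (variance_nonneg _ _)]
    push_cast
    ring_nf
  have : IsProbabilityMeasure (P.map Y) := Measure.isProbabilityMeasure_map hY
  -- By continuity at 0 the limiting characteristic function is nonzero at some t ≠ 0; the logarithm
  -- of its modulus there gives the limit of the variances.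
  obtain ⟨t, ht0, ht⟩ : ∃ t : ℝ, t ≠ 0 ∧ charFun (P.map Y) t ≠ 0 := by
    have h0 : Tendsto (charFun (P.map Y)) (𝓝[≠] 0) (𝓝 1) := by
      have := (continuous_charFun (μ := P.map Y)).tendsto 0
      simp only [charFun_zero, probReal_univ, Complex.ofReal_one] at this
      exact this.mono_left nhdsWithin_le_nhds
    obtain ⟨t, h1, h2⟩ := ((h0.eventually_ne one_ne_zero).and self_mem_nhdsWithin).exists
    exact ⟨t, h2, h1⟩
  have hvar : Tendsto (fun n => Var[X n; P]) atTop
      (𝓝 (-(2 * Real.log ‖charFun (P.map Y) t‖) / t ^ 2)) := by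
    have h1 := ((Real.continuousAt_log (norm_ne_zero_iff.2 ht)).tendsto.comp (hc t).norm)
    refine ((h1.const_mul 2).neg.div_const (t ^ 2)).congr fun n => ?_
    simp only [Function.comp_apply, hcX]
    rw [← Complex.ofReal_neg, Complex.norm_exp_ofReal, Real.log_exp]
    field_simp
  set σ := -(2 * Real.log ‖charFun (P.map Y) t‖) / t ^ 2 with hσ
  have hσ0 : 0 ≤ σ := ge_of_tendsto' hvar fun n => variance_nonneg _ _
  have hlaw : P.map Y = gaussianReal 0 σ.toNNReal := by
    refine Measure.ext_of_charFun (funext fun s => ?_)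
    refine tendsto_nhds_unique (hc s) ?_
    rw [charFun_gaussianReal, Real.coe_toNNReal _ hσ0]
    simp_rw [hcX]
    have : Continuous fun x : ℝ => Complex.exp (-(x * s ^ 2 / 2 : ℝ)) := by fun_prop
    convert! (this.tendsto σ).comp hvar using 2
    push_cast
    ring_nf
  have hG : HasGaussianLaw Y P := ⟨by rw [hlaw]; infer_instance⟩
  refine ⟨hG, ?_, ?_⟩
  · have : ∫ ω, Y ω ∂P = ∫ x, x ∂(P.map Y) := 
      (integral_map (f := fun x => x) hY (by fun_prop)).symm
    rw [this, hlaw, integral_id_gaussianReal]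
  · have : Var[Y; P] = Var[fun x => x; P.map Y] :=
      (variance_map (X := fun x => x) (by fun_prop) hY).symm
    rw [this, hlaw, variance_fun_id_gaussianReal, Real.coe_toNNReal _ hσ0]
    exact hvar

/-- An almost sure limit of centred Gaussian vectors is centred Gaussian, and the covariances
converge. -/
theorem hasGaussianLaw_pi_of_tendsto_ae {ι : Type*} [Fintype ι] {X : ℕ → ι → Ω → ℝ} {Y : ι → Ω → ℝ}
    (hX : ∀ n, HasGaussianLaw (fun ω i => X n i ω) P) (hX0 : ∀ n i, ∫ ω, X n i ω ∂P = 0)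
    (hlim : ∀ i, ∀ᵐ ω ∂P, Tendsto (fun n => X n i ω) atTop (𝓝 (Y i ω))) :
    HasGaussianLaw (fun ω i => Y i ω) P ∧ (∀ i, ∫ ω, Y i ω ∂P = 0) ∧
      ∀ i j, Tendsto (fun n => cov[X n i, X n j; P]) atTop (𝓝 cov[Y i, Y j; P]) := by
  classical
  have hXi : ∀ n i, HasGaussianLaw (X n i) P := fun n i => (hX n).eval i
  have hlim' : ∀ᵐ ω ∂P, Tendsto (fun n i => X n i ω) atTop (𝓝 fun i => Y i ω) := by
    filter_upwards [ae_all_iff.2 hlim] with ω hω using tendsto_pi_nhds.2 hω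
  have hY : ∀ i, AEMeasurable (Y i) P := fun i => aemeasurable_of_tendsto_metrizable_ae atTop
    (fun n => (hXi n i).aemeasurable) (hlim i)
  have hYi := fun i => hasGaussianLaw_of_tendsto_ae (fun n => hXi n i) (fun n => hX0 n i) (hlim i)
  have hmem : ∀ {Z : Ω → ℝ}, HasGaussianLaw Z P → MemLp Z 2 P := fun h => h.memLp_two
  refine ⟨⟨isGaussian_of_isGaussian_map fun L => ?_⟩, fun i => (hYi i).2.1, fun i j => ?_⟩
  · have hYv : AEMeasurable (fun ω i => Y i ω) P := aemeasurable_pi_lambda _ hY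
    rw [AEMeasurable.map_map_of_aemeasurable (by fun_prop) hYv]
    have hmean : ∀ n, ∫ ω, L (fun i => X n i ω) ∂P = 0 := by
      intro n
      have hint : Integrable (fun ω i => X n i ω) P := (hX n).integrable
      rw [L.integral_comp_comm hint]
      have : ∫ ω, (fun i => X n i ω) ∂P = 0 := by
        ext i
        rw [eval_integral (fun i => (hXi n i).integrable)]
        exact hX0 n i
      rw [this, map_zero]
    refine (hasGaussianLaw_of_tendsto_ae (fun n => (hX n).map_fun L) hmean ?_).1.isGaussian_map
    filter_upwards [hlim'] with ω hω
    exact (L.continuous.tendsto _).comp hω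
  -- Polarization reduces covariances to variances of sums, to which the scalar result applies.
  · have hpol : ∀ {U V : Ω → ℝ}, MemLp U 2 P → MemLp V 2 P →
        cov[U, V; P] = (Var[U + V; P] - Var[U; P] - Var[V; P]) / 2 := by
      intro U V hU hV
      rw [variance_add hU hV]; ring
    have hsum := hasGaussianLaw_of_tendsto_ae (X := fun n => X n i + X n j) (Y := Y i + Y j)
      (fun n => ((hX n).prodMk i j).add) (fun n => ?_) ?_
    · rw [hpol (hmem (hYi i).1) (hmem (hYi j).1)]
      simp_rw [hpol (hmem (hXi _ i)) (hmem (hXi _ j))]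
      exact ((hsum.2.2.sub (hYi i).2.2).sub (hYi j).2.2).div_const 2
    · simp only [Pi.add_apply]
      rw [integral_add (hXi n i).integrable (hXi n j).integrable, hX0, hX0, add_zero]
    · filter_upwards [hlim i, hlim j] with ω h1 h2 using h1.add h2

end AlmostSureLimits

/-! ### The density of a nondegenerate Gaussian vector -/

section Density

theorem lintegral_fin_prod_eq_prod {n : ℕ} {μ : Fin n → Measure ℝ} [∀ i, SigmaFinite (μ i)]
    {f : Fin n → ℝ → ℝ≥0∞} (hf : ∀ i, Measurable (f i)) :
    ∫⁻ x, ∏ i, f i (x i) ∂(Measure.pi μ) = ∏ i, ∫⁻ x, f i x ∂(μ i) := by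
  induction n with
  | zero => simp
  | succ n ih =>
    have hm : Measurable fun x : Fin n → ℝ => ∏ i : Fin n, f i.succ (x i) :=
      Finset.measurable_prod _ fun i _ => (hf i.succ).comp (measurable_pi_apply i)
    calc
      _ = ∫⁻ x : ℝ × (Fin n → ℝ), f 0 x.1 * ∏ i : Fin n, f i.succ (x.2 i)
            ∂((μ 0).prod (Measure.pi fun i => μ i.succ)) := by
        rw [← ((measurePreserving_piFinSuccAbove μ 0).symm).lintegral_comp
          (f := fun x : Fin (n + 1) → ℝ => ∏ i, f i (x i)) (Finset.measurable_prod _ fun i _ => (hf i).comp (measurable_pi_apply i))]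
        simp_rw [MeasurableEquiv.piFinSuccAbove_symm_apply, Fin.insertNthEquiv,
          Fin.prod_univ_succ, Fin.insertNth_zero, Equiv.coe_fn_mk, Fin.cons_succ,
          Fin.zero_succAbove, Fin.cons_zero]
        rfl
      _ = (∫⁻ x, f 0 x ∂(μ 0)) * ∏ i : Fin n, ∫⁻ x, f i.succ x ∂(μ i.succ) := by
        rw [← ih fun i => hf i.succ, ← lintegral_prod_mul (hf 0).aemeasurable hm.aemeasurable]
      _ = ∏ i, ∫⁻ x, f i x ∂(μ i) := by rw [Fin.prod_univ_succ]

theorem pi_withDensity {n : ℕ} {f : Fin n → ℝ → ℝ≥0∞} (hf : ∀ i, Measurable (f i))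
    [∀ i, SigmaFinite ((volume : Measure ℝ).withDensity (f i))] :
    Measure.pi (fun i => (volume : Measure ℝ).withDensity (f i)) =
      (volume : Measure (Fin n → ℝ)).withDensity fun x => ∏ i, f i (x i) := by
  refine Measure.pi_eq fun s hs => ?_
  rw [withDensity_apply _ (MeasurableSet.univ_pi hs), volume_pi, Measure.restrict_pi_pi,
    lintegral_fin_prod_eq_prod hf]
  exact Finset.prod_congr rfl fun i _ => (withDensity_apply _ (hs i)).symm

open Matrix in
/-- The standard normal distribution on `ℝⁿ` pushed forward by a symmetric invertible matrix `B`
has the normal density with covariance matrix `B * B`. -/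
theorem map_mulVec_pi_gaussianReal {n : ℕ} {B : Matrix (Fin n) (Fin n) ℝ} (hB : Bᵀ = B)
    (hdet : B.det ≠ 0) :
    (Measure.pi fun _ : Fin n => gaussianReal 0 1).map (fun x => B.mulVec x) =
      (volume : Measure (Fin n → ℝ)).withDensity
        fun x => ENNReal.ofReal (normalDensity 0 (B * B) x) := by
  have hunit : IsUnit B.det := isUnit_iff_ne_zero.2 hdet
  have hBm : Measurable fun x : Fin n → ℝ => B.mulVec x :=
    (Continuous.matrix_mulVec continuous_const continuous_id).measurable
  have hfm : Measurable fun x : Fin n → ℝ => ENNReal.ofReal (normalDensity 0 (B * B) x) := by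
    refine (Continuous.measurable ?_).ennreal_ofReal
    unfold normalDensity
    fun_prop
  -- Under x ↦ B x the quadratic form of (B B)⁻¹ becomes |x|², so the two densities differ only by
  -- the Jacobian |det B|.
  have hdens : ∀ x : Fin n → ℝ, ∏ i, gaussianPDF 0 1 (x i) =
      ENNReal.ofReal |B.det| * ENNReal.ofReal (normalDensity 0 (B * B) (B.mulVec x)) := by
    intro x
    simp only [gaussianPDF]
    rw [← ENNReal.ofReal_prod_of_nonneg (fun i _ => gaussianPDFReal_nonneg _ _ _),
      ← ENNReal.ofReal_mul (abs_nonneg _)]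
    congr 1
    have hq : B.mulVec x ⬝ᵥ ((B * B)⁻¹.mulVec (B.mulVec x)) = ∑ i, x i ^ 2 := by
      rw [mulVec_mulVec, Matrix.mul_inv_rev, Matrix.mul_assoc, nonsing_inv_mul _ hunit,
        Matrix.mul_one, dotProduct_comm, dotProduct_mulVec, vecMul_mulVec, transpose_nonsing_inv,
        hB, nonsing_inv_mul _ hunit, vecMul_one, dotProduct]
      simp only [sq]
    have hs : Real.sqrt ((2 * Real.pi) ^ n * (B * B).det) =
        Real.sqrt (2 * Real.pi) ^ n * |B.det| := by
      rw [det_mul, Real.sqrt_mul (by positivity), Real.sqrt_mul_self_eq_abs]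
      congr 1
      rw [Real.sqrt_eq_iff_mul_self_eq (by positivity) (by positivity), ← mul_pow,
        Real.mul_self_sqrt (by positivity)]
    rw [normalDensity, sub_zero, hq, hs]
    simp only [gaussianPDFReal, NNReal.coe_one, mul_one, sub_zero]
    rw [Finset.prod_mul_distrib, ← Real.exp_sum, Finset.prod_const, Finset.card_univ,
      Fintype.card_fin, ← Finset.sum_div, Finset.sum_neg_distrib]
    have : |B.det| ≠ 0 := abs_ne_zero.2 hdet
    have hpi : Real.sqrt (2 * Real.pi) ≠ 0 := by positivity
    rw [inv_pow]
    field_simp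
  have h1 : (Measure.pi fun _ : Fin n => gaussianReal 0 1) =
      (volume : Measure (Fin n → ℝ)).withDensity fun x => ∏ i, gaussianPDF 0 1 (x i) := by
    have : gaussianReal 0 1 = (volume : Measure ℝ).withDensity (gaussianPDF 0 1) :=
      gaussianReal_of_var_ne_zero 0 one_ne_zero
    have hsf : SigmaFinite ((volume : Measure ℝ).withDensity (gaussianPDF 0 1)) := by
      rw [← this]; infer_instance
    rw [this, pi_withDensity fun _ => measurable_gaussianPDF 0 1]
  ext s hs
  rw [h1, Measure.map_apply hBm hs, withDensity_apply _ (hBm hs), withDensity_apply _ hs]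
  simp_rw [hdens]
  rw [lintegral_const_mul (f := fun x => ENNReal.ofReal (normalDensity 0 (B * B) (B.mulVec x)))
    _ (hfm.comp hBm)]
  have hvol := Real.map_matrix_volume_pi_eq_smul_volume_pi hdet
  have hB' : (fun x => B.mulVec x) = ⇑(Matrix.toLin' B) := by
    ext x; simp
  rw [← setLIntegral_map hs hfm hBm, hB', hvol, Measure.restrict_smul, lintegral_smul_measure,
    smul_eq_mul, ← mul_assoc, ← ENNReal.ofReal_mul (abs_nonneg _), ← abs_mul,
    mul_inv_cancel₀ hdet]
  simp

variable {Ω : Type*} [MeasurableSpace Ω] {P : Measure Ω} [IsProbabilityMeasure P]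

open Matrix MatrixOrder in
/-- A centred Gaussian vector with positive definite covariance matrix has the normal density. -/
theorem map_eq_withDensity_normalDensity {n : ℕ} {J : Fin n → Ω → ℝ}
    (hJ : HasGaussianLaw (fun ω i => J i ω) P) (hJ0 : ∀ i, ∫ ω, J i ω ∂P = 0)
    (hS : (covMatrix J P).PosDef) :
    P.map (fun ω i => J i ω) = (volume : Measure (Fin n → ℝ)).withDensity
      fun x => ENNReal.ofReal (normalDensity 0 (covMatrix J P) x) := by
  set S := covMatrix J P with hSdef
  have hJm : AEMeasurable (fun ω i => J i ω) P := hJ.aemeasurable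
  have hmem : ∀ i, MemLp (J i) 2 P := fun i => (hJ.eval i).memLp_two
  obtain ⟨B, hB, hBB⟩ : ∃ B : Matrix (Fin n) (Fin n) ℝ, Bᵀ = B ∧ B * B = S := by
    refine ⟨CFC.sqrt S, ?_, CFC.sqrt_mul_sqrt_self _ hS.posSemidef.nonneg⟩
    have := (CFC.sqrt_nonneg S).isSelfAdjoint.star_eq
    rwa [star_eq_conjTranspose, conjTranspose_eq_transpose_of_trivial] at this
  have hdet0 : B.det ≠ 0 := by
    intro h
    have := hS.det_pos
    rw [← hBB, det_mul, h] at this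
    simp at this
  have hunit : IsUnit B.det := isUnit_iff_ne_zero.2 hdet0
  have hBm : Measurable fun x : Fin n → ℝ => B.mulVec x :=
    (Continuous.matrix_mulVec continuous_const continuous_id).measurable
  rw [← hBB, ← map_mulVec_pi_gaussianReal hB hdet0]
  -- Whitening by the inverse of the positive square root B of S: the coordinates become
  -- uncorrelated with unit variance, hence independent standard normal, and J = B T.
  let T : Fin n → Ω → ℝ := fun i ω => ∑ k, B⁻¹ i k * J k ω
  have hTB : ∀ ω, (fun i => T i ω) = B⁻¹.mulVec fun i => J i ω := fun ω => rfl
  have hTG : HasGaussianLaw (fun ω i => T i ω) P :=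
    hJ.map_fun (LinearMap.toContinuousLinearMap (Matrix.toLin' B⁻¹))
  have hTi : ∀ i, HasGaussianLaw (T i) P := fun i => hTG.eval i
  have hT0 : ∀ i, ∫ ω, T i ω ∂P = 0 := by
    intro i
    simp only [T]
    rw [integral_finsetSum _ fun k _ => ((hJ.eval k).integrable).const_mul _]
    simp [integral_const_mul, hJ0]
  have hTcov : ∀ i j, cov[T i, T j; P] = (1 : Matrix (Fin n) (Fin n) ℝ) i j := by
    intro i j
    have e : B⁻¹ * S * (B⁻¹)ᵀ = 1 := by
      rw [← hBB, transpose_nonsing_inv, hB, ← Matrix.mul_assoc, nonsing_inv_mul _ hunit,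
        Matrix.one_mul, Matrix.mul_nonsing_inv _ hunit]
    rw [← e, covariance_fun_sum_fun_sum (fun k => (hmem k).const_mul _)
      (fun k => (hmem k).const_mul _)]
    simp_rw [covariance_const_mul_left, covariance_const_mul_right, Matrix.mul_apply,
      Finset.sum_mul]
    rw [Finset.sum_comm]
    refine Finset.sum_congr rfl fun k _ => Finset.sum_congr rfl fun l _ => ?_
    rw [hSdef, covMatrix, of_apply, transpose_apply]
    ring
  have hind : iIndepFun T P := hTG.iIndepFun_of_covariance_eq_zero fun i j hij => by
    rw [hTcov, one_apply_ne hij]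
  have hTlaw : P.map (fun ω i => T i ω) = Measure.pi fun _ : Fin n => gaussianReal 0 1 := by
    rw [(iIndepFun_iff_map_fun_eq_pi_map fun i => (hTi i).aemeasurable).1 hind]
    congr 1
    ext1 i
    rw [(hTi i).map_eq_gaussianReal, hT0, ← covariance_self (hTi i).aemeasurable, hTcov,
      one_apply_eq, Real.toNNReal_one]
  rw [← hTlaw, AEMeasurable.map_map_of_aemeasurable hBm.aemeasurable hTG.aemeasurable]
  congr 1
  ext1 ω
  simp only [Function.comp_apply, hTB]
  rw [mulVec_mulVec, Matrix.mul_nonsing_inv _ hunit, one_mulVec]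

end Density

/-! ### The probability of one marked upward step -/

section UpcrossingProbability

variable {Ω : Type*} [MeasurableSpace Ω] {P : Measure Ω} [IsProbabilityMeasure P]

/-- Almost surely the limit avoids the frontier of B, so membership in B is eventually constant
along the sequence and dominated convergence applies to indicators. -/
theorem tendsto_measure_preimage_of_tendsto_ae {E : Type*} [TopologicalSpace E] [MeasurableSpace E]
    [OpensMeasurableSpace E] {Y : ℕ → Ω → E} {Y₀ : Ω → E} (hY : ∀ n, AEMeasurable (Y n) P)
    (hY₀ : AEMeasurable Y₀ P)
    (hlim : ∀ᵐ ω ∂P, Tendsto (fun n => Y n ω) atTop (𝓝 (Y₀ ω))) {B : Set E} (hB : MeasurableSet B)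
    (hfr : P.map Y₀ (frontier B) = 0) :
    Tendsto (fun n => P (Y n ⁻¹' B)) atTop (𝓝 (P (Y₀ ⁻¹' B))) := by
  classical
  have key : ∀ {Z : Ω → E}, AEMeasurable Z P →
      P (Z ⁻¹' B) = ∫⁻ ω, (Z ⁻¹' B).indicator (fun _ => (1 : ℝ≥0∞)) ω ∂P := fun hZ =>
    (lintegral_indicator_one₀ (hZ.nullMeasurableSet_preimage hB)).symm
  rw [key hY₀]
  simp_rw [key (hY _)]
  refine tendsto_lintegral_of_dominated_convergence' (fun _ => 1) (fun n => ?_) (fun n => ?_)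
    (by simp) ?_
  · exact aemeasurable_const.indicator₀ ((hY n).nullMeasurableSet_preimage hB)
  · exact Eventually.of_forall fun ω => indicator_le_self' (fun _ _ => zero_le) ω
  · have hfr' : ∀ᵐ ω ∂P, Y₀ ω ∉ frontier B :=
      ae_of_ae_map (p := fun y => y ∉ frontier B) hY₀ (measure_eq_zero_iff_ae_notMem.1 hfr)
    filter_upwards [hlim, hfr'] with ω h1 h2
    refine (tendsto_indicator_const_apply_iff_eventually atTop 1 ω).2 ?_
    simp only [mem_preimage]
    by_cases hin : Y₀ ω ∈ B
    · have h3 : Y₀ ω ∈ interior B := by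
        by_contra h
        exact h2 ⟨subset_closure hin, h⟩
      filter_upwards [h1 (mem_interior_iff_mem_nhds.1 h3)] with n hn
      exact ⟨fun _ => hin, fun _ => hn⟩
    · have h3 : Y₀ ω ∈ interior Bᶜ := by
        rw [interior_compl]
        exact fun h => h2 ⟨h, fun h' => hin (interior_subset h')⟩
      filter_upwards [h1 (mem_interior_iff_mem_nhds.1 h3)] with n hn
      exact ⟨fun h => absurd h hn, fun h => absurd h hin⟩

theorem lintegral_eq_ofReal_mul_lintegral_comp_mul {a : ℝ} (ha : a ≠ 0) (G : ℝ → ℝ≥0∞) :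
    ∫⁻ z, G z = ENNReal.ofReal |a| * ∫⁻ u, G (a * u) := by
  conv_lhs => rw [← Real.smul_map_volume_mul_left ha]
  rw [lintegral_smul_measure, smul_eq_mul]
  congr 1
  exact lintegral_map_equiv G (MeasurableEquiv.mulLeft₀ a ha)

/-- The probability of a marked upward step of size `h`, for a Gaussian variable `Z` and an
increment `h * ℓ (R + Z • c)`, with `R` independent of `Z`. -/
theorem measure_upcrossing_eq {Z : Ω → ℝ} {s : NNReal} (hs : s ≠ 0)
    (hZm : AEMeasurable Z P) (hZ : P.map Z = gaussianReal 0 s) {R : Ω → ℝ × ℝ}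
    (hR : AEMeasurable R P) (hind : IndepFun Z R P) (ℓ : ℝ × ℝ →L[ℝ] ℝ) {A : Set (ℝ × ℝ)}
    (hA : MeasurableSet A) {h : ℝ} (hh : 0 < h) (c : ℝ × ℝ) :
    P {ω | Z ω ≤ 0 ∧ 0 < Z ω + h * ℓ (R ω + Z ω • c) ∧ R ω + Z ω • c ∈ A} =
      ENNReal.ofReal h * ∫⁻ u in Ioi 0, gaussianPDF 0 s (-h * u) *
        P ((fun ω => R ω - (h * u) • c) ⁻¹' (A ∩ {y | u < ℓ y})) := by
  set E : Set (ℝ × (ℝ × ℝ)) :=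
    {p | p.1 ≤ 0 ∧ 0 < p.1 + h * ℓ (p.2 + p.1 • c) ∧ p.2 + p.1 • c ∈ A} with hE
  have hEm : MeasurableSet E := by
    have m1 : Measurable fun p : ℝ × (ℝ × ℝ) => p.1 + h * ℓ (p.2 + p.1 • c) :=
      Continuous.measurable (by fun_prop)
    have m2 : Measurable fun p : ℝ × (ℝ × ℝ) => p.2 + p.1 • c := Continuous.measurable (by fun_prop)
    exact (measurableSet_le measurable_fst measurable_const).inter
      ((measurableSet_lt measurable_const m1).inter (m2 hA))
  have h1 : P {ω | Z ω ≤ 0 ∧ 0 < Z ω + h * ℓ (R ω + Z ω • c) ∧ R ω + Z ω • c ∈ A} =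
      P.map (fun ω => (Z ω, R ω)) E := by
    rw [Measure.map_apply_of_aemeasurable (hZm.prodMk hR) hEm]; rfl
  have hpm : Measurable (fun z => P.map R (Prod.mk z ⁻¹' E)) := measurable_measure_prodMk_left hEm
  -- After conditioning on Z = z, the substitution z = -h u produces the factor h and turns the step
  -- condition into 0 ≤ u < ℓ(R - h u c).
  rw [h1, hind.map_prod_eq_prod_map_map hZm hR, hZ, Measure.prod_apply hEm,
    gaussianReal_of_var_ne_zero _ hs,
    lintegral_withDensity_eq_lintegral_mul _ (measurable_gaussianPDF _ _) hpm,
    lintegral_eq_ofReal_mul_lintegral_comp_mul (neg_ne_zero.2 hh.ne'), abs_neg, abs_of_pos hh,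
    restrict_Ioi_eq_restrict_Ici, ← lintegral_indicator measurableSet_Ici]
  congr 1
  refine lintegral_congr fun u => ?_
  rw [Pi.mul_apply, Measure.map_apply_of_aemeasurable hR (measurable_prodMk_left hEm)]
  by_cases hu : 0 ≤ u
  · rw [indicator_of_mem (mem_Ici.2 hu)]
    congr 2
    ext ω
    have e : R ω + (-h * u) • c = R ω - (h * u) • c := by
      rw [neg_mul, neg_smul, sub_eq_add_neg]
    simp only [hE, mem_preimage, mem_ofPred_eq, mem_inter_iff, e]
    have hhu : 0 ≤ h * u := mul_nonneg hh.le hu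
    have : 0 < -h * u + h * ℓ (R ω - (h * u) • c) ↔ u < ℓ (R ω - (h * u) • c) := by
      rw [show -h * u + h * ℓ (R ω - (h * u) • c) = h * (ℓ (R ω - (h * u) • c) - u) by ring,
        mul_pos_iff_of_pos_left hh, sub_pos]
    rw [this]
    constructor
    · rintro ⟨-, h2, h3⟩; exact ⟨h3, h2⟩
    · rintro ⟨h3, h2⟩; exact ⟨by linarith, h2, h3⟩
  · rw [indicator_of_notMem (by simpa using hu)]
    have : R ⁻¹' (Prod.mk (-h * u) ⁻¹' E) = ∅ := by
      ext ω
      simp only [hE, mem_preimage, mem_ofPred_eq, mem_empty_iff_false, iff_false, not_and]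
      intro h2
      nlinarith
    rw [this, measure_empty, mul_zero]

/-- Small time limit of the probability of a marked upward step. -/
theorem tendsto_measure_upcrossing {Z : Ω → ℝ} {s : NNReal} (hs : s ≠ 0)
    (hZm : AEMeasurable Z P) (hZ : P.map Z = gaussianReal 0 s) {R : ℕ → Ω → ℝ × ℝ}
    {R₀ : Ω → ℝ × ℝ} (hR : ∀ n, AEMeasurable (R n) P) (hR₀ : AEMeasurable R₀ P)
    (hind : ∀ n, IndepFun Z (R n) P)
    (hlim : ∀ᵐ ω ∂P, Tendsto (fun n => R n ω) atTop (𝓝 (R₀ ω)))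
    (hac : P.map R₀ ≪ volume) (ℓ : ℝ × ℝ →L[ℝ] ℝ) {M : ℝ≥0∞} (hM : M ≠ ∞)
    (hbd : ∀ n, ∫⁻ ω, ENNReal.ofReal (ℓ (R n ω) ^ 2) ∂P ≤ M) {A : Set (ℝ × ℝ)}
    (hA : MeasurableSet A) (hAc : Convex ℝ A) {c : ℕ → ℝ × ℝ} {c₀ : ℝ × ℝ}
    (hc : Tendsto c atTop (𝓝 c₀)) {h : ℕ → ℝ} (hpos : ∀ n, 0 < h n)
    (hh : Tendsto h atTop (𝓝 0)) :
    Tendsto (fun n => ENNReal.ofReal (h n)⁻¹ *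
      P {ω | Z ω ≤ 0 ∧ 0 < Z ω + h n * ℓ (R n ω + Z ω • c n) ∧ R n ω + Z ω • c n ∈ A})
      atTop (𝓝 (gaussianPDF 0 s 0 *
        ∫⁻ ω, A.indicator (fun y => ENNReal.ofReal (ℓ y)) (R₀ ω) ∂P)) := by
  classical
  have hBc : ∀ u : ℝ, Convex ℝ (A ∩ {y | u < ℓ y}) := fun u =>
    hAc.inter (convex_halfSpace_gt ℓ.isLinear u)
  have hBm : ∀ u : ℝ, MeasurableSet (A ∩ {y | u < ℓ y}) := fun u =>
    hA.inter (measurableSet_lt measurable_const ℓ.continuous.measurable)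
  have hmax0 : ∀ x, gaussianPDF 0 s x ≤ gaussianPDF 0 s 0 := by
    intro x
    unfold gaussianPDF gaussianPDFReal
    refine ENNReal.ofReal_le_ofReal (mul_le_mul_of_nonneg_left ?_ (by positivity))
    refine Real.exp_le_exp.2 ?_
    simp only [sub_zero, ne_eq, OfNat.ofNat_ne_zero, not_false_eq_true, zero_pow, neg_zero, zero_div]
    exact div_nonpos_of_nonpos_of_nonneg (by nlinarith [sq_nonneg x]) (by positivity)
  have hlhs : ∀ n, ENNReal.ofReal (h n)⁻¹ *
      P {ω | Z ω ≤ 0 ∧ 0 < Z ω + h n * ℓ (R n ω + Z ω • c n) ∧ R n ω + Z ω • c n ∈ A} =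
      ∫⁻ u in Ioi 0, gaussianPDF 0 s (-h n * u) *
        P ((fun ω => R n ω - (h n * u) • c n) ⁻¹' (A ∩ {y | u < ℓ y})) := by
    intro n
    rw [measure_upcrossing_eq hs hZm hZ (hR n) (hind n) ℓ hA (hpos n), ← mul_assoc,
      ← ENNReal.ofReal_mul (inv_nonneg.2 (hpos n).le), inv_mul_cancel₀ (hpos n).ne',
      ENNReal.ofReal_one, one_mul]
  -- Layer-cake formula: the mean of ℓ(R₀)⁺ over R₀ ∈ A is the integral over u > 0 of P(R₀ ∈ A,
  -- ℓ(R₀) > u).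
  have hrhs : gaussianPDF 0 s 0 * ∫⁻ ω, A.indicator (fun y => ENNReal.ofReal (ℓ y)) (R₀ ω) ∂P =
      ∫⁻ u in Ioi 0, gaussianPDF 0 s 0 * P (R₀ ⁻¹' (A ∩ {y | u < ℓ y})) := by
    rw [lintegral_const_mul' (gaussianPDF 0 s 0) _ ENNReal.ofReal_ne_top]
    congr 1
    have hmeas : AEMeasurable (fun ω => max (A.indicator (fun y => ℓ y) (R₀ ω)) 0) P :=
      (((ℓ.continuous.measurable.indicator hA).comp_aemeasurable hR₀).max aemeasurable_const)
    have hlc := lintegral_eq_lintegral_meas_lt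
      (f := fun ω => max (A.indicator (fun y => ℓ y) (R₀ ω)) 0) P
      (Eventually.of_forall fun ω => le_max_right _ _) hmeas
    have e1 : ∀ ω, A.indicator (fun y => ENNReal.ofReal (ℓ y)) (R₀ ω) =
        ENNReal.ofReal (max (A.indicator (fun y => ℓ y) (R₀ ω)) 0) := by
      intro ω
      by_cases hω : R₀ ω ∈ A
      · rw [indicator_of_mem hω, indicator_of_mem hω]
        rcases le_total (ℓ (R₀ ω)) 0 with h0 | h0
        · rw [max_eq_right h0, ENNReal.ofReal_of_nonpos h0, ENNReal.ofReal_zero]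
        · rw [max_eq_left h0]
      · simp [hω]
    simp_rw [e1]
    rw [hlc]
    refine setLIntegral_congr_fun measurableSet_Ioi fun u hu => ?_
    congr 1
    ext ω
    have hu0 : ¬ u < 0 := not_lt.2 (le_of_lt hu)
    by_cases hω : R₀ ω ∈ A
    · simp [hω, hu0]
    · simp [hω, hu0]
  rw [hrhs]
  simp_rw [hlhs]
  refine tendsto_lintegral_filter_of_dominated_convergence
    (fun u => gaussianPDF 0 s 0 * ((1 + 4 * M) * ENNReal.ofReal (1 + u ^ 2)⁻¹)) ?_ ?_ ?_ ?_
  · refine Eventually.of_forall fun n => ?_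
    set E : Set (ℝ × (ℝ × ℝ)) := (fun p => p.2 - (h n * p.1) • c n) ⁻¹' A ∩
      {p | p.1 < ℓ (p.2 - (h n * p.1) • c n)} with hE
    have m1 : Measurable fun p : ℝ × (ℝ × ℝ) => p.2 - (h n * p.1) • c n :=
      Continuous.measurable (by fun_prop)
    have hEm : MeasurableSet E :=
      (m1 hA).inter (measurableSet_lt measurable_fst (ℓ.continuous.measurable.comp m1))
    have hpm : Measurable (fun z => P.map (R n) (Prod.mk z ⁻¹' E)) :=
      measurable_measure_prodMk_left hEm
    have e : ∀ u : ℝ, P ((fun ω => R n ω - (h n * u) • c n) ⁻¹' (A ∩ {y | u < ℓ y})) =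
        P.map (R n) (Prod.mk u ⁻¹' E) := fun u => by
      rw [Measure.map_apply_of_aemeasurable (hR n) (measurable_prodMk_left hEm)]; rfl
    simp_rw [e]
    exact ((measurable_gaussianPDF 0 s).comp (measurable_const_mul _)).mul hpm
  -- Once |h ℓ(c)| < 1/2, the event u < ℓ(R - h u c) forces ℓ(R) ≥ u/2, so 1 + u² ≤ 1 + 4 ℓ(R)².
  -- Markov's inequality then gives the integrable majorant (1 + 4 M)/(1 + u²).
  · have hsmall : ∀ᶠ n in atTop, |h n * ℓ (c n)| < 1 / 2 := by
      have : Tendsto (fun n => |h n * ℓ (c n)|) atTop (𝓝 0) := by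
        have := (hh.mul ((ℓ.continuous.tendsto c₀).comp hc)).abs
        simpa using this
      exact this (Iio_mem_nhds (by norm_num))
    filter_upwards [hsmall] with n hn
    filter_upwards [ae_restrict_mem measurableSet_Ioi] with u hu
    have hu0 : 0 < u := hu
    refine mul_le_mul' (hmax0 _) ?_
    have hsub : (fun ω => R n ω - (h n * u) • c n) ⁻¹' (A ∩ {y | u < ℓ y}) ⊆
        {ω | ENNReal.ofReal (1 + u ^ 2) ≤ 1 + 4 * ENNReal.ofReal (ℓ (R n ω) ^ 2)} := by
      rintro ω ⟨-, hω⟩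
      simp only [mem_ofPred_eq, map_sub, map_smul, smul_eq_mul] at hω
      have h1 : u / 2 ≤ ℓ (R n ω) := by nlinarith [(abs_lt.1 hn).1]
      have h2 : 1 + u ^ 2 ≤ 1 + 4 * ℓ (R n ω) ^ 2 := by nlinarith
      calc ENNReal.ofReal (1 + u ^ 2) ≤ ENNReal.ofReal (1 + 4 * ℓ (R n ω) ^ 2) :=
            ENNReal.ofReal_le_ofReal h2
        _ = _ := by
          rw [ENNReal.ofReal_add (by norm_num) (by positivity), ENNReal.ofReal_mul (by norm_num)]
          norm_num
    have hmeas : AEMeasurable (fun ω => ENNReal.ofReal (ℓ (R n ω) ^ 2)) P :=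
      ((ℓ.continuous.measurable.comp_aemeasurable (hR n)).pow_const 2).ennreal_ofReal
    have hmk := mul_meas_ge_le_lintegral₀ ((hmeas.const_mul 4).const_add 1)
      (ENNReal.ofReal (1 + u ^ 2))
    rw [lintegral_add_left' aemeasurable_const, lintegral_const_mul'' _ hmeas,
      lintegral_const, measure_univ, mul_one] at hmk
    have hne : ENNReal.ofReal (1 + u ^ 2) ≠ 0 := by
      rw [ENNReal.ofReal_ne_zero_iff]; positivity
    calc _ ≤ _ := measure_mono hsub
      _ ≤ (1 + 4 * ∫⁻ ω, ENNReal.ofReal (ℓ (R n ω) ^ 2) ∂P) / ENNReal.ofReal (1 + u ^ 2) := by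
        rw [ENNReal.le_div_iff_mul_le (Or.inl hne) (Or.inl ENNReal.ofReal_ne_top), mul_comm]
        exact hmk
      _ ≤ _ := by
        rw [ENNReal.ofReal_inv_of_pos (by positivity), ENNReal.div_eq_inv_mul, mul_comm]
        gcongr
        exact hbd n
  · rw [lintegral_const_mul _ (by fun_prop), lintegral_const_mul _ (by fun_prop)]
    refine ENNReal.mul_ne_top ENNReal.ofReal_ne_top (ENNReal.mul_ne_top ?_ ?_)
    · exact ENNReal.add_ne_top.2 ⟨by simp, ENNReal.mul_ne_top (by simp) hM⟩
    · exact (integrable_inv_one_add_sq.integrableOn (s := Ioi 0)).lintegral_lt_top.ne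
  · refine Eventually.of_forall fun u => ?_
    have hp : Tendsto (fun n => gaussianPDF 0 s (-h n * u)) atTop (𝓝 (gaussianPDF 0 s 0)) := by
      have hcont : Continuous (gaussianPDF 0 s) := by
        unfold gaussianPDF gaussianPDFReal
        exact ENNReal.continuous_ofReal.comp (by fun_prop)
      refine (hcont.tendsto 0).comp ?_
      simpa using hh.neg.mul_const u
    -- Convex sets have Lebesgue-null frontier, hence null for the absolutely continuous law of R₀.
    have hq := tendsto_measure_preimage_of_tendsto_ae (P := P)
      (Y := fun n ω => R n ω - (h n * u) • c n) (Y₀ := R₀)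
      (fun n => (hR n).sub_const _) hR₀ ?_ (hBm u) (hac ((hBc u).addHaar_frontier _))
    · refine ENNReal.Tendsto.mul hp (Or.inr (measure_ne_top _ _)) hq (Or.inr ENNReal.ofReal_ne_top)
    · filter_upwards [hlim] with ω hω
      have := hω.sub ((hh.mul_const u).smul hc)
      simpa using this

end UpcrossingProbability

/-! ### Regression on the first coordinate -/

section ResidualDensity

open Matrix in
/-- Regression of a centred normal density on its first coordinate. -/
theorem normalDensity_regression {S : Matrix (Fin 3) (Fin 3) ℝ} (hS : S.PosDef) (z : ℝ)
    (y : ℝ × ℝ) :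
    normalDensity 0 S ![z, y.1 + z * (S 1 0 / S 0 0), y.2 + z * (S 2 0 / S 0 0)] =
      Real.exp (-z ^ 2 / (2 * S 0 0)) * normalDensity 0 S ![0, y.1, y.2] := by
  have hs : 0 < S 0 0 := hS.diag_pos
  have hunit : IsUnit S.det := isUnit_iff_ne_zero.2 hS.det_pos.ne'
  have hsym : Sᵀ = S := by
    have := hS.isHermitian.eq
    rwa [conjTranspose_eq_transpose_of_trivial] at this
  set e : Fin 3 → ℝ := ![1, 0, 0] with he
  set x₀ : Fin 3 → ℝ := ![0, y.1, y.2] with hx₀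
  have hcol : S.mulVec e = fun i => S i 0 := by
    ext i
    simp [he, mulVec, dotProduct, Fin.sum_univ_three]
  -- The regression shift is a multiple of the first column S e. Since S⁻¹ S e = e is orthogonal to
  -- x₀, the quadratic form splits without a cross term.
  have hx : ![z, y.1 + z * (S 1 0 / S 0 0), y.2 + z * (S 2 0 / S 0 0)] =
      (z / S 0 0) • S.mulVec e + x₀ := by
    rw [hcol]
    ext i
    fin_cases i
    · simp [hx₀, hs.ne']
    · simp [hx₀]; ring
    · simp [hx₀]; ring
  have h1 : S⁻¹.mulVec (S.mulVec e) = e := by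
    rw [mulVec_mulVec, nonsing_inv_mul _ hunit, one_mulVec]
  have h2 : S.mulVec e ⬝ᵥ S⁻¹.mulVec x₀ = 0 := by
    rw [dotProduct_mulVec, ← mulVec_transpose, transpose_nonsing_inv, hsym, h1]
    simp [he, hx₀, dotProduct, Fin.sum_univ_three]
  have h3 : x₀ ⬝ᵥ e = 0 := by simp [he, hx₀, dotProduct, Fin.sum_univ_three]
  have h4 : S.mulVec e ⬝ᵥ e = S 0 0 := by
    rw [hcol]; simp [he, dotProduct, Fin.sum_univ_three]
  have hq : ((z / S 0 0) • S.mulVec e + x₀) ⬝ᵥ S⁻¹.mulVec ((z / S 0 0) • S.mulVec e + x₀) =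
      z ^ 2 / S 0 0 + x₀ ⬝ᵥ S⁻¹.mulVec x₀ := by
    rw [mulVec_add, mulVec_smul, h1, add_dotProduct, dotProduct_add, dotProduct_add,
      smul_dotProduct, smul_dotProduct, dotProduct_smul, dotProduct_smul, h2, h3, h4]
    simp only [smul_eq_mul]
    field_simp
    ring
  unfold normalDensity
  rw [hx, sub_zero, sub_zero, hq, ← mul_div_assoc, ← Real.exp_add]
  congr 2
  field_simp
  ring

theorem measurePreserving_vecCons3 :
    MeasurePreserving (fun p : ℝ × (ℝ × ℝ) => (![p.1, p.2.1, p.2.2] : Fin 3 → ℝ)) := by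
  have h1 := (volume_preserving_piFinSuccAbove (fun _ : Fin 3 => ℝ) 0).symm
  have h2 := (volume_preserving_finTwoArrow ℝ).symm
  have h3 := h1.comp ((MeasurePreserving.id (volume : Measure ℝ)).prod h2)
  rw [Measure.volume_eq_prod]
  convert h3 using 1
  ext p i
  fin_cases i <;> rfl

theorem continuous_normalDensity {n : ℕ} (S : Matrix (Fin n) (Fin n) ℝ) :
    Continuous (normalDensity 0 S) := by
  unfold normalDensity
  fun_prop

theorem continuous_normalDensity_vec (S : Matrix (Fin 3) (Fin 3) ℝ) :
    Continuous fun p : ℝ × (ℝ × ℝ) => normalDensity 0 S ![p.1, p.2.1, p.2.2] :=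
  (continuous_normalDensity S).comp (by fun_prop)

variable {Ω : Type*} [MeasurableSpace Ω] {P : Measure Ω} [IsProbabilityMeasure P]

/-- The residual of a centred normal vector in `ℝ³` after regression on its first coordinate has
the density which conditions the first coordinate to be zero. -/
theorem lintegral_residual {J : Fin 3 → Ω → ℝ}
    (hJ : HasGaussianLaw (fun ω i => J i ω) P) (hJ0 : ∀ i, ∫ ω, J i ω ∂P = 0)
    {S : Matrix (Fin 3) (Fin 3) ℝ} (hSJ : S = covMatrix J P) (hS : S.PosDef)
    {g : ℝ × ℝ → ℝ≥0∞} (hg : Measurable g) :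
    gaussianPDF 0 (S 0 0).toNNReal 0 *
        ∫⁻ ω, g ((J 1 ω, J 2 ω) - J 0 ω • (S 1 0 / S 0 0, S 2 0 / S 0 0)) ∂P =
      ∫⁻ y : ℝ × ℝ, g y * ENNReal.ofReal (normalDensity 0 S ![0, y.1, y.2]) := by
  have hs : 0 < S 0 0 := hS.diag_pos
  set c : ℝ × ℝ := (S 1 0 / S 0 0, S 2 0 / S 0 0) with hc
  have hlaw := map_eq_withDensity_normalDensity hJ hJ0 (hSJ ▸ hS)
  rw [← hSJ] at hlaw
  have hfm : Measurable fun x : Fin 3 → ℝ => ENNReal.ofReal (normalDensity 0 S x) :=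
    (continuous_normalDensity S).measurable.ennreal_ofReal
  have hGm : Measurable fun x : Fin 3 → ℝ => g ((x 1, x 2) - x 0 • c) :=
    hg.comp (Continuous.measurable (by fun_prop))
  have hfm' : Measurable fun p : ℝ × (ℝ × ℝ) =>
      ENNReal.ofReal (normalDensity 0 S ![p.1, p.2.1, p.2.2]) :=
    (continuous_normalDensity_vec S).measurable.ennreal_ofReal
  have hGm' : Measurable fun p : ℝ × (ℝ × ℝ) => g (p.2 - p.1 • c) :=
    hg.comp (Continuous.measurable (by fun_prop))
  have e1 : ∫⁻ ω, g ((J 1 ω, J 2 ω) - J 0 ω • c) ∂P =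
      ∫⁻ x : Fin 3 → ℝ, ENNReal.ofReal (normalDensity 0 S x) * g ((x 1, x 2) - x 0 • c) := by
    rw [← lintegral_map' (f := fun x : Fin 3 → ℝ => g ((x 1, x 2) - x 0 • c))
      hGm.aemeasurable hJ.aemeasurable, hlaw, lintegral_withDensity_eq_lintegral_mul _ hfm hGm]
    rfl
  have e2 : ∫⁻ x : Fin 3 → ℝ, ENNReal.ofReal (normalDensity 0 S x) * g ((x 1, x 2) - x 0 • c) =
      ∫⁻ z : ℝ, ∫⁻ y : ℝ × ℝ, ENNReal.ofReal (normalDensity 0 S ![z, y.1, y.2]) *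
        g (y - z • c) := by
    rw [← measurePreserving_vecCons3.lintegral_comp (f := fun x : Fin 3 → ℝ =>
        ENNReal.ofReal (normalDensity 0 S x) * g ((x 1, x 2) - x 0 • c)) (hfm.mul hGm), Measure.volume_eq_prod]
    exact lintegral_prod _ (hfm'.mul hGm').aemeasurable
  have e3 : ∀ z : ℝ, ∫⁻ y : ℝ × ℝ, ENNReal.ofReal (normalDensity 0 S ![z, y.1, y.2]) *
        g (y - z • c) = ENNReal.ofReal (Real.exp (-z ^ 2 / (2 * S 0 0))) *
          ∫⁻ y : ℝ × ℝ, g y * ENNReal.ofReal (normalDensity 0 S ![0, y.1, y.2]) := by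
    intro z
    rw [← lintegral_add_right_eq_self _ (z • c), ← lintegral_const_mul' _ _ ENNReal.ofReal_ne_top]
    refine lintegral_congr fun y => ?_
    have := normalDensity_regression hS z y
    simp only [hc, Prod.fst_add, Prod.snd_add, Prod.smul_fst, Prod.smul_snd, smul_eq_mul,
      add_sub_cancel_right] at this ⊢
    rw [this, ENNReal.ofReal_mul (Real.exp_pos _).le]
    ring
  have e4 : ∀ z : ℝ, gaussianPDF 0 (S 0 0).toNNReal 0 *
      ENNReal.ofReal (Real.exp (-z ^ 2 / (2 * S 0 0))) = gaussianPDF 0 (S 0 0).toNNReal z := by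
    intro z
    unfold gaussianPDF gaussianPDFReal
    rw [← ENNReal.ofReal_mul (by positivity), Real.coe_toNNReal _ hs.le]
    simp
  rw [e1, e2]
  simp_rw [e3]
  rw [lintegral_mul_const _ (by fun_prop), ← mul_assoc,
    ← lintegral_const_mul' (gaussianPDF 0 (S 0 0).toNNReal 0) _ ENNReal.ofReal_ne_top]
  simp_rw [e4]
  rw [lintegral_gaussianPDF_eq_one _ (by simpa using hs), one_mul]

end ResidualDensity

/-! ### Difference jets of the sea and the one-cell limit -/

section Field

variable {Ω : Type*} {W : ℝ × ℝ → Ω → ℝ}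

/-- The value of the field at the origin, with the mark of step `h` there. -/
noncomputable def diffJet (W : ℝ × ℝ → Ω → ℝ) (v h : ℝ) : Fin 3 → Ω → ℝ :=
  ![W (0, 0), fun ω => (diffMark (fun p => W p ω) v h 0).1,
    fun ω => (diffMark (fun p => W p ω) v h 0).2]

/-- The difference jet as a linear function of the three values of the field it uses. -/
noncomputable def diffJetCLM (v h : ℝ) : (Fin 3 → ℝ) →L[ℝ] (Fin 3 → ℝ) :=
  ContinuousLinearMap.pi
    ![.proj 0, h⁻¹ • (.proj 1 - .proj 0),
      h⁻¹ • (.proj 2 - .proj 0) - (v * h⁻¹) • (.proj 1 - .proj 0)]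

theorem diffJet_eq (v h : ℝ) (ω : Ω) :
    (fun i => diffJet W v h i ω) =
      diffJetCLM v h (fun i => W (![(0, 0), (h, 0), (v * h, h)] i) ω) := by
  ext i
  fin_cases i
  · simp [diffJet, diffJetCLM]
  · simp [diffJet, diffJetCLM, diffMark]; ring
  · simp [diffJet, diffJetCLM, diffMark]; ring

variable [MeasurableSpace Ω] {P : Measure Ω}

theorem IsGaussianSea.hasGaussianLaw_pi (hW : IsGaussianSea W P) {n : ℕ} (p : Fin n → ℝ × ℝ) :
    HasGaussianLaw (fun ω i => W (p i) ω) P :=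
  ((hW.gaussian.comp_right p).hasGaussianLaw Finset.univ).map_fun
    (ContinuousLinearMap.pi fun i =>
      ContinuousLinearMap.proj (R := ℝ) (φ := fun _ : (Finset.univ : Finset (Fin n)) => ℝ)
        ⟨i, Finset.mem_univ i⟩)

theorem IsGaussianSea.hasGaussianLaw_diffJet (hW : IsGaussianSea W P) (v h : ℝ) :
    HasGaussianLaw (fun ω i => diffJet W v h i ω) P := by
  rw [show (fun ω i => diffJet W v h i ω) = fun ω => diffJetCLM v h
    (fun i => W (![(0, 0), (h, 0), (v * h, h)] i) ω) from funext fun ω => diffJet_eq v h ω]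
  exact (hW.hasGaussianLaw_pi _).map_fun _

theorem IsGaussianSea.integral_diffJet (hW : IsGaussianSea W P) (v h : ℝ) (i : Fin 3) :
    ∫ ω, diffJet W v h i ω ∂P = 0 := by
  have hG := hW.hasGaussianLaw_pi ![(0, 0), (h, 0), (v * h, h)]
  have h1 : ∫ ω, (fun j => diffJet W v h j ω) ∂P = 0 := by
    rw [show (fun ω i => diffJet W v h i ω) = fun ω => diffJetCLM v h
      (fun i => W (![(0, 0), (h, 0), (v * h, h)] i) ω) from funext fun ω => diffJet_eq v h ω,
      ContinuousLinearMap.integral_comp_comm _ hG.integrable]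
    have : ∫ ω, (fun j => W (![(0, 0), (h, 0), (v * h, h)] j) ω) ∂P = 0 := by
      ext j
      rw [eval_integral fun j => (hG.eval j).integrable]
      exact hW.mean_zero _
    rw [this, map_zero]
  have h2 := congrFun h1 i
  rwa [eval_integral fun j => ((hW.hasGaussianLaw_diffJet v h).eval j).integrable] at h2

theorem IsGaussianSea.tendsto_diffJet (hW : IsGaussianSea W P) (v : ℝ) (i : Fin 3) :
    ∀ᵐ ω ∂P, Tendsto (fun n : ℕ => diffJet W v ((1 / 2) ^ n) i ω) atTop (𝓝 (jet W i ω)) := by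
  filter_upwards [hW.contDiff] with ω hω
  have h1 := (tendsto_diffMark hω v 0).comp (tendsto_half_pow.prodMk
    (tendsto_const_nhds (x := (0 : ℝ))))
  rw [mul_zero] at h1
  fin_cases i
  · exact tendsto_const_nhds
  · exact (continuous_fst.tendsto _).comp h1
  · exact (continuous_snd.tendsto _).comp h1

variable [IsProbabilityMeasure P]

/-- The jet is an almost sure limit of difference jets, each linear in three values of the field.
The difference jets depend on v but their limit does not, so v = 0 suffices for the law. -/
theorem IsGaussianSea.jet_law (hW : IsGaussianSea W P) :
    HasGaussianLaw (fun ω i => jet W i ω) P ∧ (∀ i, ∫ ω, jet W i ω ∂P = 0) ∧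
      ∀ v i j, Tendsto (fun n : ℕ => cov[diffJet W v ((1 / 2) ^ n) i, diffJet W v ((1 / 2) ^ n) j; P])
        atTop (𝓝 (covMatrix (jet W) P i j)) := by
  have key := fun v : ℝ => hasGaussianLaw_pi_of_tendsto_ae
    (X := fun n : ℕ => diffJet W v ((1 / 2) ^ n)) (Y := jet W)
    (fun n => hW.hasGaussianLaw_diffJet v _) (fun n => hW.integral_diffJet v _)
    (hW.tendsto_diffJet v)
  exact ⟨(key 0).1, (key 0).2.1, fun v => (key v).2.2⟩

theorem IsGaussianSea.meanVec_jet (hW : IsGaussianSea W P) : meanVec (jet W) P = 0 :=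
  funext hW.jet_law.2.1

/-- The derivative along the course of the ship as a function of the slope and the time
derivative. -/
noncomputable def courseSlope (v : ℝ) : ℝ × ℝ →L[ℝ] ℝ :=
  v • ContinuousLinearMap.fst ℝ ℝ ℝ + ContinuousLinearMap.snd ℝ ℝ ℝ

@[simp]
theorem courseSlope_apply (v : ℝ) (y : ℝ × ℝ) : courseSlope v y = v * y.1 + y.2 := rfl

/-- The intensity measure of the marks at upward zero crossings. -/
noncomputable def markMeasure (W : ℝ × ℝ → Ω → ℝ) (P : Measure Ω) (v : ℝ) : Measure (ℝ × ℝ) :=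
  volume.withDensity fun y => ENNReal.ofReal (courseSlope v y) *
    ENNReal.ofReal (normalDensity 0 (covMatrix (jet W) P) ![0, y.1, y.2])

theorem continuous_normalDensity_zero (S : Matrix (Fin 3) (Fin 3) ℝ) :
    Continuous fun y : ℝ × ℝ => normalDensity 0 S ![0, y.1, y.2] :=
  (continuous_normalDensity S).comp (by fun_prop)

/-- The coefficients make the residual uncorrelated with X₀; joint Gaussianity upgrades this to
independence. -/
theorem indepFun_regression_residual {X : Fin 3 → Ω → ℝ} (hX : HasGaussianLaw (fun ω i => X i ω) P)
    (h0 : Var[X 0; P] ≠ 0) :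
    IndepFun (X 0) (fun ω => (X 1 ω, X 2 ω) -
      X 0 ω • (cov[X 1, X 0; P] / Var[X 0; P], cov[X 2, X 0; P] / Var[X 0; P])) P := by
  set c : ℝ × ℝ := (cov[X 1, X 0; P] / Var[X 0; P], cov[X 2, X 0; P] / Var[X 0; P]) with hc
  have hmem : ∀ i, MemLp (X i) 2 P := fun i => (hX.eval i).memLp_two
  have hpair : HasGaussianLaw (fun ω => (X 0 ω, (X 1 ω, X 2 ω) - X 0 ω • c)) P := by
    let L : (Fin 3 → ℝ) →L[ℝ] ℝ × (ℝ × ℝ) := ContinuousLinearMap.prod (.proj 0)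
      (ContinuousLinearMap.prod (.proj 1) (.proj 2) - (ContinuousLinearMap.proj 0 : (Fin 3 → ℝ) →L[ℝ] ℝ).smulRight c)
    exact hX.map_fun L
  refine hpair.indepFun_of_covariance_strongDual fun L₁ L₂ => ?_
  have e1 : L₁ ∘ X 0 = fun ω => L₁ 1 * X 0 ω := by
    ext ω
    have := L₁.map_smul (X 0 ω) 1
    simp only [smul_eq_mul, mul_one] at this
    simp [this, mul_comm]
  have e2 : L₂ ∘ (fun ω => (X 1 ω, X 2 ω) - X 0 ω • c) =
      fun ω => L₂ (1, 0) * (X 1 ω - c.1 * X 0 ω) + L₂ (0, 1) * (X 2 ω - c.2 * X 0 ω) := by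
    ext ω
    have : (X 1 ω, X 2 ω) - X 0 ω • c =
        (X 1 ω - c.1 * X 0 ω) • ((1 : ℝ), (0 : ℝ)) + (X 2 ω - c.2 * X 0 ω) • ((0 : ℝ), (1 : ℝ)) := by
      ext <;> simp [mul_comm]
    simp only [Function.comp_apply, this, map_add, map_smul, smul_eq_mul]
    ring
  have hres : ∀ i : Fin 3, ∀ a : ℝ, a = cov[X i, X 0; P] / Var[X 0; P] →
      cov[X 0, fun ω => X i ω - a * X 0 ω; P] = 0 := by
    intro i a ha
    rw [covariance_fun_sub_right (hmem 0) (hmem i) ((hmem 0).const_mul a),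
      covariance_const_mul_right, covariance_self (hX.eval 0).aemeasurable, ha,
      div_mul_cancel₀ _ h0, covariance_comm, sub_self]
  have hm : ∀ (i : Fin 3) (a b : ℝ), MemLp (fun ω => b * (X i ω - a * X 0 ω)) 2 P := fun i a b =>
    ((hmem i).sub ((hmem 0).const_mul a)).const_mul b
  have hadd := covariance_add_right (hmem 0) (hm 1 c.1 (L₂ (1, 0))) (hm 2 c.2 (L₂ (0, 1)))
  rw [e1, e2, covariance_const_mul_left]
  refine mul_eq_zero_of_right _ (hadd.trans ?_)
  rw [covariance_const_mul_right, covariance_const_mul_right, hres 1 _ rfl, hres 2 _ rfl]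
  simp

/-- Small time limit of the probability of a marked upward step at the origin. -/
theorem IsGaussianSea.tendsto_measure_upStep (hW : IsGaussianSea W P)
    (hS : (covMatrix (jet W) P).PosDef) (v : ℝ) {A : Set (ℝ × ℝ)} (hA : MeasurableSet A)
    (hAc : Convex ℝ A) :
    Tendsto (fun n : ℕ => (2 : ℝ≥0∞) ^ n * P {ω | UpStep (fun s => encSea W v s ω)
      (diffMark (fun p => W p ω) v) A ((1 / 2) ^ n) 0}) atTop (𝓝 (markMeasure W P v A)) := by
  obtain ⟨hJ, hJ0, hcov⟩ := hW.jet_law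
  set S := covMatrix (jet W) P with hSdef
  have hs : 0 < S 0 0 := hS.diag_pos
  set X : ℕ → Fin 3 → Ω → ℝ := fun n => diffJet W v ((1 / 2) ^ n) with hX
  have hX0 : ∀ n, X n 0 = W (0, 0) := fun n => rfl
  have hXG : ∀ n, HasGaussianLaw (fun ω i => X n i ω) P := fun n => hW.hasGaussianLaw_diffJet v _
  have hZG : HasGaussianLaw (W (0, 0)) P := hJ.eval 0
  have hvar : Var[W (0, 0); P] = S 0 0 := (covariance_self hZG.aemeasurable).symm
  set c : ℕ → ℝ × ℝ := fun n => (cov[X n 1, X n 0; P] / S 0 0, cov[X n 2, X n 0; P] / S 0 0)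
  set c₀ : ℝ × ℝ := (S 1 0 / S 0 0, S 2 0 / S 0 0) with hc₀
  have hc : Tendsto c atTop (𝓝 c₀) :=
    ((hcov v 1 0).div_const _).prodMk_nhds ((hcov v 2 0).div_const _)
  set R : ℕ → Ω → ℝ × ℝ := fun n ω => (X n 1 ω, X n 2 ω) - W (0, 0) ω • c n with hR
  set R₀ : Ω → ℝ × ℝ := fun ω => (jet W 1 ω, jet W 2 ω) - jet W 0 ω • c₀ with hR₀
  have hRG : ∀ n, HasGaussianLaw (R n) P := by
    intro n
    let L : (Fin 3 → ℝ) →L[ℝ] ℝ × ℝ :=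
      ContinuousLinearMap.prod (.proj 1) (.proj 2) - (ContinuousLinearMap.proj 0 : (Fin 3 → ℝ) →L[ℝ] ℝ).smulRight (c n)
    exact (hXG n).map_fun L
  have hR₀m : AEMeasurable R₀ P := by
    let L : (Fin 3 → ℝ) →L[ℝ] ℝ × ℝ :=
      ContinuousLinearMap.prod (.proj 1) (.proj 2) - (ContinuousLinearMap.proj 0 : (Fin 3 → ℝ) →L[ℝ] ℝ).smulRight c₀
    exact (hJ.map_fun L).aemeasurable
  have hind : ∀ n, IndepFun (W (0, 0)) (R n) P := by
    intro n
    have := indepFun_regression_residual (hXG n) (by rw [hX0, hvar]; exact hs.ne')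
    rw [hX0, hvar] at this
    exact this
  have hlim : ∀ᵐ ω ∂P, Tendsto (fun n => R n ω) atTop (𝓝 (R₀ ω)) := by
    filter_upwards [hW.tendsto_diffJet v 1, hW.tendsto_diffJet v 2] with ω h1 h2
    exact (h1.prodMk_nhds h2).sub (hc.const_smul _)
  have hdens : ∀ {g : ℝ × ℝ → ℝ≥0∞}, Measurable g →
      gaussianPDF 0 (S 0 0).toNNReal 0 * ∫⁻ ω, g (R₀ ω) ∂P =
        ∫⁻ y : ℝ × ℝ, g y * ENNReal.ofReal (normalDensity 0 S ![0, y.1, y.2]) := fun hg =>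
    lintegral_residual hJ hJ0 rfl hS hg
  have hs' : (S 0 0).toNNReal ≠ 0 := by simpa using hs
  -- Testing the density identity on indicators of null sets suffices, because the factor f_Z(0) is
  -- positive.
  have hac : P.map R₀ ≪ volume := by
    refine Measure.AbsolutelyContinuous.mk fun B hB hB0 => ?_
    have h1 := hdens (measurable_one.indicator hB)
    have h2 : ∫⁻ y : ℝ × ℝ, B.indicator 1 y *
        ENNReal.ofReal (normalDensity 0 S ![0, y.1, y.2]) = 0 := by
      rw [lintegral_eq_zero_iff' (by
        exact ((measurable_one.indicator hB).mul
          (continuous_normalDensity_zero S).measurable.ennreal_ofReal).aemeasurable)]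
      filter_upwards [measure_eq_zero_iff_ae_notMem.1 hB0] with y hy
      simp [hy]
    rw [h2] at h1
    rcases mul_eq_zero.1 h1 with h3 | h3
    · exact absurd h3 (gaussianPDF_pos _ hs' _).ne'
    · rw [Measure.map_apply_of_aemeasurable hR₀m hB,
        ← lintegral_indicator_one₀ (hR₀m.nullMeasurableSet_preimage hB)]
      exact h3
  obtain ⟨M, hM, hbd⟩ : ∃ M : ℝ≥0∞, M ≠ ∞ ∧
      ∀ n, ∫⁻ ω, ENNReal.ofReal (courseSlope v (R n ω) ^ 2) ∂P ≤ M := by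
    have hYG : ∀ n, HasGaussianLaw (fun ω => courseSlope v (R n ω)) P := fun n =>
      (hRG n).map_fun _
    have hR0 : ∀ n, ∫ ω, R n ω ∂P = 0 := by
      intro n
      have h1 : ∀ i, Integrable (X n i) P := fun i => ((hXG n).eval i).integrable
      have h2 : ∀ i, ∫ ω, X n i ω ∂P = 0 := fun i => hW.integral_diffJet v _ i
      rw [integral_sub ((h1 1).prodMk (h1 2)) (hZG.integrable.smul_const _),
        integral_smul_const, hW.mean_zero, zero_smul, sub_zero, integral_pair (h1 1) (h1 2), h2, h2]
      rfl
    have hY0 : ∀ n, ∫ ω, courseSlope v (R n ω) ∂P = 0 := by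
      intro n
      rw [ContinuousLinearMap.integral_comp_comm _ (hRG n).integrable, hR0, map_zero]
    -- The variances converge, hence are bounded; this is the uniform second moment needed for
    -- domination.
    have hYlim := (hasGaussianLaw_of_tendsto_ae hYG hY0 (Y := fun ω => courseSlope v (R₀ ω)) (by
      filter_upwards [hlim] with ω hω
      exact ((courseSlope v).continuous.tendsto _).comp hω)).2.2
    obtain ⟨b, hb⟩ := hYlim.bddAbove_range
    refine ⟨ENNReal.ofReal b, ENNReal.ofReal_ne_top, fun n => ?_⟩
    rw [← ofReal_integral_eq_lintegral_ofReal (hYG n).memLp_two.integrable_sq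
      (Eventually.of_forall fun ω => sq_nonneg _)]
    refine ENNReal.ofReal_le_ofReal ?_
    rw [← variance_of_integral_eq_zero (hYG n).aemeasurable (hY0 n)]
    exact hb (mem_range_self n)
  have hmain := tendsto_measure_upcrossing hs' hZG.aemeasurable
    (by rw [hZG.map_eq_gaussianReal, hW.mean_zero, hvar]) (fun n => (hRG n).aemeasurable) hR₀m hind
    hlim hac (courseSlope v) hM hbd hA hAc hc (h := fun n => (1 / 2) ^ n) (fun n => by positivity)
    (tendsto_half_pow.mono_right nhdsWithin_le_nhds)
  rw [hdens ((courseSlope v).continuous.measurable.ennreal_ofReal.indicator hA)] at hmain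
  have hI : ∫⁻ y : ℝ × ℝ, A.indicator (fun y => ENNReal.ofReal (courseSlope v y)) y *
      ENNReal.ofReal (normalDensity 0 S ![0, y.1, y.2]) = markMeasure W P v A := by
    rw [markMeasure, withDensity_apply _ hA, ← lintegral_indicator hA]
    refine lintegral_congr fun y => ?_
    by_cases hy : y ∈ A <;> simp [hy, hSdef]
  rw [hI] at hmain
  refine hmain.congr fun n => ?_
  congr 1
  · rw [← inv_pow, one_div, inv_inv, ENNReal.ofReal_pow (by norm_num)]
    norm_num
  · congr 1
    ext ω
    have e1 : R n ω + W (0, 0) ω • c n = diffMark (fun p => W p ω) v ((1 / 2) ^ n) 0 := by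
      simp only [hR, sub_add_cancel]
      rfl
    have hne : ((1 : ℝ) / 2) ^ n ≠ 0 := by positivity
    -- The correction in the mark is designed so that ℓ(mark) is exactly the difference quotient of
    -- Z.
    have e2 : W (0, 0) ω + (1 / 2) ^ n *
        courseSlope v (diffMark (fun p => W p ω) v ((1 / 2) ^ n) 0) =
        encSea W v (0 + (1 / 2) ^ n) ω := by
      simp only [courseSlope_apply, diffMark, encSea, mul_zero]
      field_simp
      ring
    simp only [mem_ofPred_eq, UpStep, e1, e2]
    simp [encSea]

end Field

/-! ### From grid counts to the Rice formula -/

section Counting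

variable {Ω : Type*} {W : ℝ × ℝ → Ω → ℝ}

/-- The values of the field at three points which witness a marked upward step. -/
def upStepValues (v h : ℝ) (A : Set (ℝ × ℝ)) : Set (Fin 3 → ℝ) :=
  {x | x 0 ≤ 0 ∧ 0 < x 2 ∧ ((x 1 - x 0) / h, (x 2 - x 0) / h - v * ((x 1 - x 0) / h)) ∈ A}

theorem measurableSet_upStepValues (v h : ℝ) {A : Set (ℝ × ℝ)} (hA : MeasurableSet A) :
    MeasurableSet (upStepValues v h A) := by
  have m : Measurable fun x : Fin 3 → ℝ =>
      ((x 1 - x 0) / h, (x 2 - x 0) / h - v * ((x 1 - x 0) / h)) :=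
    Continuous.measurable (by fun_prop)
  exact (measurableSet_le (measurable_pi_apply 0) measurable_const).inter
    ((measurableSet_lt measurable_const (measurable_pi_apply 2)).inter (m hA))

/-- A step at s is a condition on three values of the field translated by (v s, s), so stationarity
makes its probability independent of s. -/
theorem setOf_upStep_eq (W : ℝ × ℝ → Ω → ℝ) (v h s : ℝ) (A : Set (ℝ × ℝ)) :
    {ω | UpStep (fun s => encSea W v s ω) (diffMark (fun p => W p ω) v) A h s} =
      (fun ω i => W ((![(0, 0), (h, 0), (v * h, h)] : Fin 3 → ℝ × ℝ) i + (v * s, s)) ω) ⁻¹'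
        upStepValues v h A := by
  ext ω
  have e1 : ((0 : ℝ), (0 : ℝ)) + (v * s, s) = (v * s, s) := by simp
  have e2 : (h, (0 : ℝ)) + (v * s, s) = (v * s + h, s) := by ext <;> simp [add_comm]
  have e3 : (v * h, h) + (v * s, s) = (v * (s + h), s + h) := by ext <;> simp <;> ring
  simp [UpStep, upStepValues, encSea, diffMark, e1, e2, e3]

theorem gridCount_mono_set {Z : ℝ → ℝ} {m : ℝ → ℝ → ℝ × ℝ} {A B : Set (ℝ × ℝ)} (h : A ⊆ B)
    (n : ℕ) : gridCount Z m A n ≤ gridCount Z m B n := by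
  classical
  exact Finset.card_le_card (Finset.monotone_filter_right _ fun k _ hk => ⟨hk.1, hk.2.1, h hk.2.2⟩)

theorem coe_gridCount (Z : ℝ → ℝ) (m : ℝ → ℝ → ℝ × ℝ) (A : Set (ℝ × ℝ)) (n : ℕ) :
    (gridCount Z m A n : ℝ≥0∞) = ∑ k ∈ Finset.range (2 ^ n),
      {s | UpStep Z m A ((1 / 2) ^ n) s}.indicator 1 (k * (1 / 2) ^ n) := by
  classical
  rw [gridCount, Finset.card_filter]
  push_cast
  refine Finset.sum_congr rfl fun k _ => ?_
  simp only [indicator_apply, mem_ofPred_eq, Pi.one_apply]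

/-- The grid count of marked upward crossings of the encountered sea. -/
noncomputable def seaCount (W : ℝ × ℝ → Ω → ℝ) (v : ℝ) (A : Set (ℝ × ℝ)) (n : ℕ) (ω : Ω) : ℝ≥0∞ :=
  gridCount (fun s => encSea W v s ω) (diffMark (fun p => W p ω) v) A n

theorem seaCount_eq_sum (v : ℝ) (A : Set (ℝ × ℝ)) (n : ℕ) (ω : Ω) :
    seaCount W v A n ω = ∑ k ∈ Finset.range (2 ^ n),
      {ω | UpStep (fun s => encSea W v s ω) (diffMark (fun p => W p ω) v) A
        ((1 / 2) ^ n) (k * (1 / 2) ^ n)}.indicator 1 ω := by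
  rw [seaCount, coe_gridCount]
  rfl

/-- The overtaking times of a differentiable path in terms of its partial derivatives. -/
theorem overtakingTimes_eq {ω : Ω} (hω : ContDiff ℝ 1 fun p : ℝ × ℝ => W p ω) (v : ℝ) :
    overtakingTimes W v ω = {t | t ∈ Icc (0 : ℝ) 1 ∧ encSea W v t ω = 0 ∧
      0 < courseSlope v (Wx W (v * t) t ω, Wt W (v * t) t ω) ∧ Wx W (v * t) t ω < 0} := by
  ext t
  have : deriv (fun s => encSea W v s ω) t =
      courseSlope v (Wx W (v * t) t ω, Wt W (v * t) t ω) :=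
    (hasStrictDerivAt_course hω v t).hasDerivAt.deriv
  simp only [overtakingTimes, mem_ofPred_eq, this]

variable [MeasurableSpace Ω] {P : Measure Ω}

/-- Overtaking already requires W_x < 0, so the threshold 0 imposes nothing. -/
theorem encIntensity_eq (W : ℝ × ℝ → Ω → ℝ) (P : Measure Ω) (v : ℝ) :
    encIntensity W P v = encIntensityLe W P v 0 := by
  unfold encIntensity encIntensityLe
  refine lintegral_congr fun ω => ?_
  have h : overtakingTimes W v ω ⊆ {t | Wx W (v * t) t ω ≤ 0} := fun t ht => ht.2.2.2.le
  rw [inter_eq_left.2 h]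

theorem normalDensity_pos {n : ℕ} {S : Matrix (Fin n) (Fin n) ℝ} (hS : S.PosDef) (x : Fin n → ℝ) :
    0 < normalDensity 0 S x := by
  have := hS.det_pos
  unfold normalDensity
  positivity

theorem markMeasure_pos (hS : (covMatrix (jet W) P).PosDef) (v : ℝ) :
    0 < markMeasure W P v {y | y.1 < 0 ∧ y.1 ≤ 0} := by
  set O : Set (ℝ × ℝ) := {y | y.1 < 0} ∩ {y | 0 < courseSlope v y} with hO
  have hOo : IsOpen O := (isOpen_lt continuous_fst continuous_const).inter
    (isOpen_lt continuous_const (courseSlope v).continuous)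
  -- At a = -1, b = v + 1 the course derivative v a + b equals 1.
  have hne : O.Nonempty := ⟨(-1, v + 1), by simp [hO]⟩
  have hOpos : 0 < volume O := hOo.measure_pos _ hne
  have hmeas : Measurable fun y : ℝ × ℝ => ENNReal.ofReal (courseSlope v y) *
      ENNReal.ofReal (normalDensity 0 (covMatrix (jet W) P) ![0, y.1, y.2]) :=
    (courseSlope v).continuous.measurable.ennreal_ofReal.mul
      (continuous_normalDensity_zero _).measurable.ennreal_ofReal
  have hsub : O ⊆ {y | y.1 < 0 ∧ y.1 ≤ 0} := fun y hy => ⟨hy.1, le_of_lt hy.1⟩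
  refine lt_of_lt_of_le ?_ (measure_mono hsub)
  rw [markMeasure, withDensity_apply _ hOo.measurableSet,
    setLIntegral_pos_iff hmeas]
  refine hOpos.trans_le (measure_mono fun y hy => ⟨?_, hy⟩)
  exact mul_ne_zero (by simpa using hy.2) (by simpa using normalDensity_pos hS _)

theorem IsGaussianSea.nullMeasurableSet_upStep (hW : IsGaussianSea W P) (v h s : ℝ)
    {A : Set (ℝ × ℝ)} (hA : MeasurableSet A) :
    NullMeasurableSet
      {ω | UpStep (fun s => encSea W v s ω) (diffMark (fun p => W p ω) v) A h s} P := by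
  rw [setOf_upStep_eq]
  exact (aemeasurable_pi_lambda _ fun i => hW.gaussian.aemeasurable _).nullMeasurableSet_preimage
    (measurableSet_upStepValues v h hA)

theorem IsGaussianSea.measure_upStep_eq (hW : IsGaussianSea W P) (v h s : ℝ)
    {A : Set (ℝ × ℝ)} (hA : MeasurableSet A) :
    P {ω | UpStep (fun s => encSea W v s ω) (diffMark (fun p => W p ω) v) A h s} =
      P {ω | UpStep (fun s => encSea W v s ω) (diffMark (fun p => W p ω) v) A h 0} := by
  rw [setOf_upStep_eq, setOf_upStep_eq]
  have hm := measurableSet_upStepValues v h hA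
  exact ((hW.stationary (v * s, s) 3 ![(0, 0), (h, 0), (v * h, h)]).measure_mem_eq hm).trans
    ((hW.stationary (v * 0, 0) 3 ![(0, 0), (h, 0), (v * h, h)]).measure_mem_eq hm).symm

theorem IsGaussianSea.aemeasurable_seaCount (hW : IsGaussianSea W P) (v : ℝ) {A : Set (ℝ × ℝ)}
    (hA : MeasurableSet A) (n : ℕ) : AEMeasurable (seaCount W v A n) P := by
  have : seaCount W v A n = fun ω => ∑ k ∈ Finset.range (2 ^ n),
      {ω | UpStep (fun s => encSea W v s ω) (diffMark (fun p => W p ω) v) A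
        ((1 / 2) ^ n) (k * (1 / 2) ^ n)}.indicator 1 ω := funext (seaCount_eq_sum v A n)
  rw [this]
  exact Finset.aemeasurable_fun_sum _ fun k _ =>
    aemeasurable_const.indicator₀ (hW.nullMeasurableSet_upStep v _ _ hA)

theorem IsGaussianSea.lintegral_seaCount (hW : IsGaussianSea W P) (v : ℝ) {A : Set (ℝ × ℝ)}
    (hA : MeasurableSet A) (n : ℕ) :
    ∫⁻ ω, seaCount W v A n ω ∂P = 2 ^ n * P {ω | UpStep (fun s => encSea W v s ω)
      (diffMark (fun p => W p ω) v) A ((1 / 2) ^ n) 0} := by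
  simp_rw [seaCount_eq_sum]
  rw [lintegral_finsetSum' _ fun k _ => measurable_one.aemeasurable.indicator₀
    (hW.nullMeasurableSet_upStep v _ _ hA)]
  simp_rw [lintegral_indicator_one₀ (hW.nullMeasurableSet_upStep v _ _ hA),
    hW.measure_upStep_eq v _ (_ * _) hA]
  simp

variable [IsProbabilityMeasure P]

theorem IsGaussianSea.tendsto_lintegral_seaCount (hW : IsGaussianSea W P)
    (hS : (covMatrix (jet W) P).PosDef) (v : ℝ) {A : Set (ℝ × ℝ)} (hA : MeasurableSet A)
    (hAc : Convex ℝ A) :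
    Tendsto (fun n => ∫⁻ ω, seaCount W v A n ω ∂P) atTop (𝓝 (markMeasure W P v A)) := by
  simp_rw [hW.lintegral_seaCount v hA]
  exact hW.tendsto_measure_upStep hS v hA hAc

/-- By the residual identity the total mass is f_Z(0) times the mean of the positive part of a
Gaussian variable. -/
theorem IsGaussianSea.markMeasure_univ_lt_top (hW : IsGaussianSea W P)
    (hS : (covMatrix (jet W) P).PosDef) (v : ℝ) : markMeasure W P v univ < ∞ := by
  obtain ⟨hJ, hJ0, -⟩ := hW.jet_law
  have h := lintegral_residual hJ hJ0 rfl hS (courseSlope v).continuous.measurable.ennreal_ofReal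
  rw [markMeasure, withDensity_apply _ MeasurableSet.univ, setLIntegral_univ, ← h]
  refine ENNReal.mul_lt_top ENNReal.ofReal_lt_top ?_
  set c₀ : ℝ × ℝ := (covMatrix (jet W) P 1 0 / covMatrix (jet W) P 0 0,
    covMatrix (jet W) P 2 0 / covMatrix (jet W) P 0 0)
  let L : (Fin 3 → ℝ) →L[ℝ] ℝ × ℝ := ContinuousLinearMap.prod (.proj 1) (.proj 2) -
    (ContinuousLinearMap.proj 0 : (Fin 3 → ℝ) →L[ℝ] ℝ).smulRight c₀
  have hG : HasGaussianLaw (fun ω => courseSlope v (L fun i => jet W i ω)) P :=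
    (hJ.map_fun L).map_fun _
  exact hG.integrable.lintegral_lt_top

/-- The grid has no cell starting at t = 1, so a zero there could be missed; by stationarity Z(1)
has the atomless law of W(0, 0). -/
theorem IsGaussianSea.encSea_one_ne_zero (hW : IsGaussianSea W P)
    (hS : (covMatrix (jet W) P).PosDef) (v : ℝ) : ∀ᵐ ω ∂P, encSea W v 1 ω ≠ 0 := by
  have hs : 0 < covMatrix (jet W) P 0 0 := hS.diag_pos
  have hZG : HasGaussianLaw (W (0, 0)) P := hW.jet_law.1.eval 0
  have hvar : Var[W (0, 0); P] = covMatrix (jet W) P 0 0 := (covariance_self hZG.aemeasurable).symm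
  have hne : (Var[W (0, 0); P]).toNNReal ≠ 0 := by rw [hvar]; simpa using hs
  have h0 : P (W (0, 0) ⁻¹' {0}) = 0 := by
    rw [← Measure.map_apply_of_aemeasurable hZG.aemeasurable (measurableSet_singleton _),
      hZG.map_eq_gaussianReal]
    have := nullSingletonClass_gaussianReal (μ := ∫ ω, W (0, 0) ω ∂P) hne
    exact measure_singleton 0
  have hm : MeasurableSet {x : Fin 1 → ℝ | x 0 = 0} :=
    measurableSet_eq_fun (measurable_pi_apply 0) measurable_const
  have h1 := (hW.stationary (v * 1, 1) 1 fun _ => (0, 0)).measure_mem_eq hm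
  rw [ae_iff]
  simp only [encSea, not_not]
  refine Eq.trans (congrArg P ?_) (h1.trans h0)
  ext ω
  simp

/-- Upper bound in the Rice formula for an open convex set of marks. -/
theorem IsGaussianSea.lintegral_encard_le (hW : IsGaussianSea W P)
    (hS : (covMatrix (jet W) P).PosDef) (v : ℝ) {U : Set (ℝ × ℝ)} (hU : IsOpen U)
    (hUc : Convex ℝ U) {T : Ω → Set ℝ}
    (hT : ∀ᵐ ω ∂P, T ω ⊆ {t | t ∈ Icc (0 : ℝ) 1 ∧ encSea W v t ω = 0 ∧
      0 < courseSlope v (Wx W (v * t) t ω, Wt W (v * t) t ω) ∧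
      (Wx W (v * t) t ω, Wt W (v * t) t ω) ∈ U}) :
    ∫⁻ ω, ((T ω).encard : ℝ≥0∞) ∂P ≤ markMeasure W P v U := by
  calc ∫⁻ ω, ((T ω).encard : ℝ≥0∞) ∂P
      ≤ ∫⁻ ω, liminf (fun n => seaCount W v U n ω) atTop ∂P := by
        refine lintegral_mono_ae ?_
        filter_upwards [hT, hW.contDiff, hW.encSea_one_ne_zero hS v] with ω h1 h2 h3
        refine le_trans ?_ (encard_le_liminf_gridCount hU
          (fun s => hasStrictDerivAt_course h2 v s) (fun s => tendsto_diffMark h2 v s) h3)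
        exact ENat.toENNReal_le.2 (encard_le_encard h1)
    _ ≤ liminf (fun n => ∫⁻ ω, seaCount W v U n ω ∂P) atTop :=
        lintegral_liminf_le' fun n => hW.aemeasurable_seaCount v hU.measurableSet n
    _ = markMeasure W P v U :=
        (hW.tendsto_lintegral_seaCount hS v hU.measurableSet hUc).liminf_eq

/-- Lower bound in the Rice formula for a closed convex set of marks on which the derivative
is positive. -/
theorem IsGaussianSea.le_lintegral_encard (hW : IsGaussianSea W P)
    (hS : (covMatrix (jet W) P).PosDef) (v : ℝ) {K : Set (ℝ × ℝ)} (hK : IsClosed K)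
    (hKc : Convex ℝ K) (hpos : ∀ y ∈ K, 0 < courseSlope v y) {T : Ω → Set ℝ}
    (hT : ∀ᵐ ω ∂P, {t | t ∈ Icc (0 : ℝ) 1 ∧ encSea W v t ω = 0 ∧
      (Wx W (v * t) t ω, Wt W (v * t) t ω) ∈ K} ⊆ T ω) :
    markMeasure W P v K ≤ ∫⁻ ω, ((T ω).encard : ℝ≥0∞) ∂P := by
  have hKm := hK.measurableSet
  have hmono : ∀ ω, Monotone fun n => seaCount W v univ n ω := fun ω _ _ hab =>
    Nat.cast_le.2 (gridCount_mono hab)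
  have hle : ∀ n ω, seaCount W v K n ω ≤ ⨆ n, seaCount W v univ n ω := by
    intro n ω
    refine le_trans ?_ (le_iSup (fun n => seaCount W v univ n ω) n)
    exact Nat.cast_le.2 (gridCount_mono_set (subset_univ K) n)
  -- Monotone convergence identifies the mean of the supremum with the limit of the mean unmarked
  -- counts, the finite total mass.
  have hfin : ∫⁻ ω, ⨆ n, seaCount W v univ n ω ∂P ≠ ∞ := by
    rw [lintegral_iSup' (fun n => hW.aemeasurable_seaCount v MeasurableSet.univ n)
      (Eventually.of_forall hmono)]
    have h1 := tendsto_atTop_iSup fun (a b : ℕ) (hab : a ≤ b) =>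
      lintegral_mono (μ := P) fun ω => hmono ω hab
    rw [tendsto_nhds_unique h1 (hW.tendsto_lintegral_seaCount hS v MeasurableSet.univ convex_univ)]
    exact (hW.markMeasure_univ_lt_top hS v).ne
  have hmk := fun n => (hW.aemeasurable_seaCount v hKm n)
  -- Reverse Fatou is applied to measurable modifications, as the counts are only almost everywhere
  -- measurable.
  have hlimsup := limsup_lintegral_le (μ := P) (f := fun n => (hmk n).mk _)
    (fun ω => ⨆ n, seaCount W v univ n ω) (fun n => (hmk n).measurable_mk) (fun n => ?_) hfin
  · calc markMeasure W P v K = limsup (fun n => ∫⁻ ω, seaCount W v K n ω ∂P) atTop :=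
          (hW.tendsto_lintegral_seaCount hS v hKm hKc).limsup_eq.symm
      _ = limsup (fun n => ∫⁻ ω, (hmk n).mk _ ω ∂P) atTop := by
          simp_rw [lintegral_congr_ae (hmk _).ae_eq_mk]
      _ ≤ ∫⁻ ω, limsup (fun n => (hmk n).mk _ ω) atTop ∂P := hlimsup
      _ ≤ ∫⁻ ω, ((T ω).encard : ℝ≥0∞) ∂P := by
          refine lintegral_mono_ae ?_
          filter_upwards [hT, hW.contDiff, ae_all_iff.2 fun n => (hmk n).ae_eq_mk] with ω h1 h2 h3
          simp_rw [← h3]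
          refine limsup_le_of_le (by isBoundedDefault) ?_
          have := eventually_gridCount_le_encard (Z := fun s => encSea W v s ω) hK
            (fun s => hasStrictDerivAt_course h2 v s) (fun s => tendsto_diffMark h2 v s)
            fun s hs => hpos _ hs
          filter_upwards [this] with n hn
          have h4 := ENat.toENNReal_le.2 (hn.trans (encard_le_encard h1))
          rwa [ENat.toENNReal_coe] at h4
  · filter_upwards [(hmk n).ae_eq_mk] with ω hω
    rw [← hω]
    exact hle n ω

/-- **Rice formula** for the slopes at overtaking wave centers. -/
theorem IsGaussianSea.encIntensityLe_eq (hW : IsGaussianSea W P)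
    (hS : (covMatrix (jet W) P).PosDef) (v w : ℝ) :
    encIntensityLe W P v w = markMeasure W P v {y | y.1 < 0 ∧ y.1 ≤ w} := by
  have hfinite : IsFiniteMeasure (markMeasure W P v) := ⟨hW.markMeasure_univ_lt_top hS v⟩
  have hseq : Tendsto (fun n : ℕ => 1 / ((n : ℝ) + 1)) atTop (𝓝 0) :=
    tendsto_one_div_add_atTop_nhds_zero_nat
  have hseq0 : ∀ n : ℕ, 0 < 1 / ((n : ℝ) + 1) := fun n => Nat.one_div_pos_of_nat
  have hanti : Antitone fun n : ℕ => 1 / ((n : ℝ) + 1) := fun a b hab =>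
    Nat.one_div_le_one_div hab
  have hfst : IsLinearMap ℝ fun y : ℝ × ℝ => y.1 := (LinearMap.fst ℝ ℝ ℝ).isLinear
  refine le_antisymm ?_ ?_
  · set U : ℕ → Set (ℝ × ℝ) := fun n => {y | y.1 < 0 ∧ y.1 < w + 1 / ((n : ℝ) + 1)} with hU
    have hUo : ∀ n, IsOpen (U n) := fun n =>
      (isOpen_lt continuous_fst continuous_const).inter
        (isOpen_lt continuous_fst continuous_const)
    have hUc : ∀ n, Convex ℝ (U n) := fun n =>
      (convex_halfSpace_lt hfst _).inter (convex_halfSpace_lt hfst _)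
    have hInter : ⋂ n, U n = {y | y.1 < 0 ∧ y.1 ≤ w} := by
      ext y
      simp only [hU, mem_iInter, mem_ofPred_eq]
      refine ⟨fun h => ⟨(h 0).1, ?_⟩, fun h n => ⟨h.1, by linarith [h.2, hseq0 n]⟩⟩
      have h1 : Tendsto (fun n : ℕ => w + 1 / ((n : ℝ) + 1)) atTop (𝓝 w) := by
        simpa using hseq.const_add w
      exact ge_of_tendsto' h1 fun n => (h n).2.le
    have hlim := tendsto_measure_iInter_atTop (μ := markMeasure W P v)
      (fun n => (hUo n).measurableSet.nullMeasurableSet)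
      (fun a b hab y hy => ⟨hy.1, hy.2.trans_le (by have := hanti hab; simp only at this; linarith)⟩)
      ⟨0, measure_ne_top _ (U 0)⟩
    rw [hInter] at hlim
    refine ge_of_tendsto' hlim fun n => ?_
    refine hW.lintegral_encard_le hS v (hUo n) (hUc n) ?_
    filter_upwards [hW.contDiff] with ω hω
    rw [overtakingTimes_eq hω]
    rintro t ⟨⟨h1, h2, h3, h4⟩, h5⟩
    have h5' : Wx W (v * t) t ω ≤ w := h5
    exact ⟨h1, h2, h3, h4, by have := hseq0 n; show Wx W (v * t) t ω < _; linarith⟩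
  -- The margin 1/(n+1) turns the strict conditions W_x < 0 and Z_t > 0 into closed ones; W_x ≤ w is
  -- closed already.
  · set K : ℕ → Set (ℝ × ℝ) := fun n => {y | y.1 ≤ -(1 / ((n : ℝ) + 1)) ∧ y.1 ≤ w ∧
      1 / ((n : ℝ) + 1) ≤ courseSlope v y} with hK
    have hKc' : ∀ n, IsClosed (K n) := fun n =>
      (isClosed_le continuous_fst continuous_const).inter
        ((isClosed_le continuous_fst continuous_const).inter
          (isClosed_le continuous_const (courseSlope v).continuous))
    have hKc : ∀ n, Convex ℝ (K n) := fun n =>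
      (convex_halfSpace_le hfst _).inter ((convex_halfSpace_le hfst _).inter
        (convex_halfSpace_ge (courseSlope v).isLinear _))
    have hUnion : ⋃ n, K n = {y | y.1 < 0 ∧ y.1 ≤ w} ∩ {y | 0 < courseSlope v y} := by
      ext y
      simp only [hK, mem_iUnion, mem_ofPred_eq, mem_inter_iff]
      constructor
      · rintro ⟨n, h1, h2, h3⟩
        exact ⟨⟨by linarith [hseq0 n], h2⟩, by linarith [hseq0 n]⟩
      · rintro ⟨⟨h1, h2⟩, h3⟩
        obtain ⟨n, hn⟩ := exists_nat_one_div_lt (lt_min (neg_pos.2 h1) h3)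
        have h4 := lt_min_iff.1 hn
        exact ⟨n, by linarith [h4.1], h2, h4.2.le⟩
    have hlim := tendsto_measure_iUnion_atTop (μ := markMeasure W P v) (s := K)
      (fun a b hab y hy => by
        have := hanti hab
        simp only at this
        exact ⟨by linarith [hy.1], hy.2.1, by linarith [hy.2.2]⟩)
    have hSm : MeasurableSet {y : ℝ × ℝ | y.1 < 0 ∧ y.1 ≤ w} :=
      (measurableSet_lt measurable_fst measurable_const).inter
        (measurableSet_le measurable_fst measurable_const)
    -- The density contains (v a + b)⁺, so restricting to v a + b > 0 loses no mass.
    have hnull : markMeasure W P v {y | 0 < courseSlope v y}ᶜ = 0 := by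
      have hm : MeasurableSet {y : ℝ × ℝ | 0 < courseSlope v y} :=
        measurableSet_lt measurable_const (courseSlope v).continuous.measurable
      rw [markMeasure, withDensity_apply _ hm.compl, ← lintegral_indicator hm.compl]
      refine lintegral_eq_zero_of_ae_eq_zero (Eventually.of_forall fun y => ?_)
      by_cases hy : 0 < courseSlope v y
      · rw [indicator_of_notMem (by simpa using hy)]; rfl
      · rw [indicator_of_mem (by simpa using hy), ENNReal.ofReal_of_nonpos (not_lt.1 hy), zero_mul]
        rfl
    rw [hUnion, measure_inter_conull hnull] at hlim
    refine le_of_tendsto' hlim fun n => ?_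
    refine hW.le_lintegral_encard hS v (hKc' n) (hKc n)
      (fun y hy => (hseq0 n).trans_le hy.2.2) ?_
    filter_upwards [hW.contDiff] with ω hω
    rw [overtakingTimes_eq hω]
    rintro t ⟨h1, h2, h3, h4, h5⟩
    have h3' : Wx W (v * t) t ω ≤ -(1 / ((n : ℝ) + 1)) := h3
    exact ⟨⟨h1, h2, (hseq0 n).trans_le h5, by linarith [hseq0 n]⟩, h4⟩

/-- The integrand is nonnegative, so the Bochner integral is the `toReal` of the corresponding `∫⁻`
without a separate integrability argument. -/
theorem IsGaussianSea.condExpMulDensity_eq (hW : IsGaussianSea W P)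
    (hS : (covMatrix (jet W) P).PosDef) (v : ℝ) {B : Set ℝ} (hB : MeasurableSet B)
    {g : ℝ → ℝ → ℝ}
    (hg : ∀ a b, g a b = (Iio (0 : ℝ) ∩ B).indicator (fun a => max (v * a + b) 0) a) :
    condExpMulDensity W P g 0 = (markMeasure W P v {y | y.1 ∈ Iio (0 : ℝ) ∩ B}).toReal := by
  have hm : MeasurableSet (Iio (0 : ℝ) ∩ B) := measurableSet_Iio.inter hB
  have hm' : MeasurableSet {y : ℝ × ℝ | y.1 ∈ Iio (0 : ℝ) ∩ B} := measurable_fst hm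
  have hdpos := fun x => (normalDensity_pos hS x).le
  have hgm : Measurable fun y : ℝ × ℝ => g y.1 y.2 := by
    have : (fun y : ℝ × ℝ => g y.1 y.2) = {y : ℝ × ℝ | y.1 ∈ Iio (0 : ℝ) ∩ B}.indicator
        fun y => max (v * y.1 + y.2) 0 := by
      ext y; rw [hg]; rfl
    rw [this]
    exact (Continuous.measurable (by fun_prop)).indicator hm'
  have hg0 : ∀ a b, 0 ≤ g a b := by
    intro a b
    rw [hg]
    exact indicator_nonneg (fun _ _ => le_max_right _ _) _
  rw [condExpMulDensity, hW.meanVec_jet, integral_eq_lintegral_of_nonneg_ae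
    (Eventually.of_forall fun y => mul_nonneg (hg0 _ _) (hdpos _))
    (hgm.mul (continuous_normalDensity_zero _).measurable).aestronglyMeasurable,
    markMeasure, withDensity_apply _ hm', ← lintegral_indicator hm']
  congr 1
  refine lintegral_congr fun y => ?_
  rw [ENNReal.ofReal_mul (hg0 _ _), hg]
  by_cases hy : y.1 ∈ Iio (0 : ℝ) ∩ B
  · rw [indicator_of_mem hy, indicator_of_mem (by exact hy), courseSlope_apply]
    congr 1
    rcases le_total (v * y.1 + y.2) 0 with h0 | h0
    · rw [max_eq_right h0, ENNReal.ofReal_of_nonpos h0, ENNReal.ofReal_zero]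
    · rw [max_eq_left h0]
  · rw [indicator_of_notMem hy, indicator_of_notMem (by exact hy), ENNReal.ofReal_zero, zero_mul]

end Counting

end GaussianSea

/-! ### The Palm distribution as a ratio of intensities -/

theorem corollary6p1 {Ω : Type*} [MeasurableSpace Ω] (P : MeasureTheory.Measure Ω)
    [MeasureTheory.IsProbabilityMeasure P] (W : ℝ × ℝ → Ω → ℝ)
    (hW : GaussianSea.IsGaussianSea W P)
    (hnondeg : (GaussianSea.covMatrix (GaussianSea.jet W) P).PosDef) (v : ℝ) :
    (0 < GaussianSea.encIntensity W P v ∧ GaussianSea.encIntensity W P v < ⊤) ∧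
    0 < GaussianSea.condExpMulDensity W P
      (fun a b => max (GaussianSea.velocity a b - v) 0 * max (-a) 0) 0 ∧
    ∀ w : ℝ, GaussianSea.encSlopeCDF W P v w =
      GaussianSea.condExpMulDensity W P
        (fun a b => max (GaussianSea.velocity a b - v) 0 * max (-a) 0 *
          Set.indicator (Set.Iic w) 1 a) 0 /
      GaussianSea.condExpMulDensity W P
        (fun a b => max (GaussianSea.velocity a b - v) 0 * max (-a) 0) 0 := by
  open GaussianSea in
  -- For a < 0, multiplying -b/a - v by -a > 0 gives v a + b; for a ≥ 0 the factor a⁻ vanishes, so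
  -- the default value of division by zero is harmless.
  have hweight : ∀ a b : ℝ, max (velocity a b - v) 0 * max (-a) 0 =
      (Iio (0 : ℝ)).indicator (fun a => max (v * a + b) 0) a := by
    intro a b
    rcases lt_or_ge a 0 with ha | ha
    · rw [indicator_of_mem (mem_Iio.2 ha), max_eq_left (by linarith : (0 : ℝ) ≤ -a),
        max_mul_of_nonneg _ _ (by linarith), zero_mul, velocity]
      congr 1
      have := ha.ne
      field_simp
      ring
    · rw [indicator_of_notMem (by simpa using ha), max_eq_right (by linarith : -a ≤ 0), mul_zero]
  have hden : condExpMulDensity W P (fun a b => max (velocity a b - v) 0 * max (-a) 0) 0 =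
      (encIntensity W P v).toReal := by
    rw [encIntensity_eq, hW.encIntensityLe_eq hnondeg,
      hW.condExpMulDensity_eq hnondeg v measurableSet_Iic (B := Iic 0)]
    · rfl
    · intro a b
      rw [hweight, inter_eq_left.2 (Iio_subset_Iic_self)]
  have hnum : ∀ w, condExpMulDensity W P (fun a b => max (velocity a b - v) 0 * max (-a) 0 *
      Set.indicator (Set.Iic w) 1 a) 0 = (encIntensityLe W P v w).toReal := by
    intro w
    rw [hW.encIntensityLe_eq hnondeg,
      hW.condExpMulDensity_eq hnondeg v measurableSet_Iic (B := Iic w)]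
    · rfl
    · intro a b
      rw [hweight]
      by_cases h1 : a ∈ Iio (0 : ℝ) <;> by_cases h2 : a ∈ Iic w <;> simp [indicator, h1, h2]
  have hpos : 0 < encIntensity W P v := by
    rw [encIntensity_eq, hW.encIntensityLe_eq hnondeg]
    exact markMeasure_pos hnondeg v
  have hlt : encIntensity W P v < ⊤ := by
    rw [encIntensity_eq, hW.encIntensityLe_eq hnondeg]
    exact (measure_mono (subset_univ _)).trans_lt (hW.markMeasure_univ_lt_top hnondeg v)
  refine ⟨⟨hpos, hlt⟩, ?_, fun w => ?_⟩
  · rw [hden]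
    exact ENNReal.toReal_pos hpos.ne' hlt.ne
  · rw [hden, hnum, encSlopeCDF, ENNReal.toReal_div]
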